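/- Let $a$, $b$, $c$ be three distinct letters of an alphabet $\Sigma$. An ordinary (context-free) grammar over $\Sigma$ is \emph{unambiguous} if every word has at most one parse tree in it (with the initial symbol at the root). A language is \emph{inherently ambiguous} if it is described by some ordinary grammar, but by no unambiguous ordinary grammar. A \emph{GF(2)-grammar} over $\Sigma$ is given by an ordinary grammar over $\Sigma$ in which every word $w\in\Sigma^*$ has only finitely many parse trees; the language it describes is the set of all words that have an odd number of parse trees. Corollary. The language $\{a^n b^m c^\ell \mid n, m, \ell \geq 0,\ n \neq m \text{ or } m \neq \ell\}$ is not described by any GF(2)-grammar. Moreover, it is inherently ambiguous. -/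

import Mathlib

namespace ContextFreeGrammar

/-- `g.ParseForest [X₁, …, X_ℓ]` is the type of sequences of `ℓ` parse trees of the grammar `g`, the
`i`-th of which is a parse tree as the symbol `X_i`: a single leaf if `X_i` is a terminal; and if
`X_i` is a nonterminal, a root labelled by a rule of `g` for that nonterminal, together with the
sequence of its subtrees, which are parse trees as the symbols on the right-hand side of the rule. -/
inductive ParseForest {T : Type*} (g : ContextFreeGrammar T) : List (Symbol T g.NT) → Type _
  | nil : ParseForest g []
  | leaf (x : T) {s : List (Symbol T g.NT)} (rest : ParseForest g s) :
      ParseForest g (Symbol.terminal x :: s)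
  | node (r : ContextFreeRule T g.NT) (hr : r ∈ g.rules) (children : ParseForest g r.output)
      {s : List (Symbol T g.NT)} (rest : ParseForest g s) :
      ParseForest g (Symbol.nonterminal r.input :: s)

/-- The word formed by the leaves of a sequence of parse trees, read from left to right. -/
def ParseForest.yield {T : Type*} {g : ContextFreeGrammar T} :
    {s : List (Symbol T g.NT)} → g.ParseForest s → List T
  | _, .nil => []
  | _, .leaf x rest => x :: rest.yield
  | _, .node _ _ children rest => children.yield ++ rest.yield

/-- The parse trees of the word `w` as the nonterminal `A`. -/
def ParseTree {T : Type*} (g : ContextFreeGrammar T) (A : g.NT) (w : List T) : Type _ :=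
  {t : g.ParseForest [Symbol.nonterminal A] // t.yield = w}

/-- An (ordinary) grammar is unambiguous if every word has at most one parse tree as the initial
symbol. -/
def IsUnambiguous {T : Type*} (g : ContextFreeGrammar T) : Prop :=
  ∀ w : List T, Subsingleton (g.ParseTree g.initial w)

end ContextFreeGrammar

/-- A language is inherently ambiguous if it is described by some ordinary grammar, but by no
unambiguous one. -/
def Language.IsInherentlyAmbiguous {T : Type*} (L : Language T) : Prop :=
  L.IsContextFree ∧ ∀ g : ContextFreeGrammar T, g.language = L → ¬ g.IsUnambiguous

/-- A GF(2)-grammar: syntactically an ordinary grammar, in which every word is required to have only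
finitely many parse trees. A rule `A → X₁ … X_ℓ` stands for `A → X₁ ⊙ … ⊙ X_ℓ`. -/
structure GF2Grammar (T : Type*) where
  /-- The corresponding ordinary grammar. -/
  toCFG : ContextFreeGrammar T
  /-- Every word has finitely many parse trees as the initial symbol. -/
  finite_parseTree : ∀ w : List T, Finite (toCFG.ParseTree toCFG.initial w)

/-- The language described by a GF(2)-grammar: all words with an odd number of parse trees. -/
def GF2Grammar.language {T : Type*} (G : GF2Grammar T) : Language T :=
  {w : List T | Odd (Nat.card (G.toCFG.ParseTree G.toCFG.initial w))}

/-- The language `{aⁿ bᵐ c^ℓ | n ≠ m or m ≠ ℓ}`, where `n, m, ℓ ≥ 0`. -/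
def neOrNeLanguage {T : Type*} (a b c : T) : Language T :=
  {w : List T | ∃ n m l : ℕ, (n ≠ m ∨ m ≠ l) ∧
    w = List.replicate n a ++ List.replicate m b ++ List.replicate l c}

/-!
Count parse trees in a field `k`. For a chain of letters `e₀, e₁, …`, the parse trees of a string of
symbols whose yields have the form `e_p^{d_p} ⋯ e_q^{d_q}` give power series, the entries of an
upper triangular matrix; concatenation of strings becomes multiplication of matrices.

The `p`-th diagonal entries solve the polynomial equations of the grammar over `k(X_p)`. As a word
has only finitely many parse trees, the Jacobian matrix of these equations is `1 - M` with the
constant terms of `M` nilpotent, so the Jacobian criterion makes these entries algebraic over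
`k(X_p)`. The entries `(p, q)` above the diagonal solve a system of linear equations with a matrix
of the same shape `1 - M`, whose entries are algebraic over `k(X_p, X_q)`, and a right-hand side
that is built from entries closer to the diagonal.

A valuation ring `O` that dominates the localization of `k[X₀, …, Xₙ]` at the prime element `1 - X₀
⋯ Xₙ` contains every field of rational functions that omits a variable, because no nonzero
polynomial omitting a variable is divisible by that prime. Being integrally closed, `O` contains all
elements algebraic over such a field. With at least three letters every pair `p, q` omits a
variable, so `O` contains all the entries. If each sorted word that is not of the form `e₀^m ⋯ eₙ^m`
had exactly one parse tree, as counted in `k`, and the words `e₀^m ⋯ eₙ^m` none, then `O` would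
contain `∏ (1 - Xᵢ)⁻¹ - (1 - X₀ ⋯ Xₙ)⁻¹`. It does contain the first term but not the second.
-/

open ContextFreeGrammar

section StringLanguage

variable {T N : Type*}

/-- The language of a symbol when each nonterminal `A` is read as the language `I A`. -/
def symbolLanguage (I : N → Language T) : Symbol T N → Language T
  | .terminal x => {[x]}
  | .nonterminal A => I A

/-- The language of a string of symbols when each nonterminal `A` is read as the language `I A`. -/
def stringLanguage (I : N → Language T) (s : List (Symbol T N)) : Language T :=
  (s.map (symbolLanguage I)).prod

@[simp] lemma stringLanguage_nil (I : N → Language T) : stringLanguage I [] = 1 := rfl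

@[simp] lemma stringLanguage_cons (I : N → Language T) (X : Symbol T N) (s : List (Symbol T N)) :
    stringLanguage I (X :: s) = symbolLanguage I X * stringLanguage I s :=
  List.prod_cons

@[simp] lemma stringLanguage_append (I : N → Language T) (s t : List (Symbol T N)) :
    stringLanguage I (s ++ t) = stringLanguage I s * stringLanguage I t := by
  simp [stringLanguage]

lemma singleton_cons_eq_mul (x : T) (w : List T) :
    ({x :: w} : Language T) = {[x]} * {w} :=
  (Set.image2_singleton (f := fun u v : List T ↦ u ++ v) (a := [x]) (b := w)).symm

@[simp] lemma stringLanguage_map_terminal (I : N → Language T) (w : List T) :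
    stringLanguage I (w.map .terminal) = {w} := by
  induction w with
  | nil => rfl
  | cons x w ih => rw [List.map_cons, stringLanguage_cons, ih, singleton_cons_eq_mul]; rfl

lemma stringLanguage_le_of_rewrites {I : N → Language T} {r : ContextFreeRule T N}
    (hr : stringLanguage I r.output ≤ I r.input) {s t : List (Symbol T N)} (h : r.Rewrites s t) :
    stringLanguage I t ≤ stringLanguage I s := by
  obtain ⟨p, q, rfl, rfl⟩ := h.exists_parts
  simp only [stringLanguage_append, stringLanguage_cons, stringLanguage_nil, mul_one]
  gcongr
  exact hr

end StringLanguage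

section DerivedLanguage

variable {T : Type*} {g : ContextFreeGrammar T}

/-- The words derived from each nonterminal: the least solution of the system of language
inequalities given by the rules. -/
def derivedLanguage (g : ContextFreeGrammar T) (A : g.NT) : Language T :=
  {w | g.Derives [.nonterminal A] (w.map .terminal)}

lemma stringLanguage_le_of_derives {I : g.NT → Language T}
    (hI : ∀ r ∈ g.rules, stringLanguage I r.output ≤ I r.input) {s t : List (Symbol T g.NT)}
    (h : g.Derives s t) : stringLanguage I t ≤ stringLanguage I s := by
  induction h with
  | refl => rfl
  | tail _ h ih =>
    obtain ⟨r, hr, hrw⟩ := h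
    exact (stringLanguage_le_of_rewrites (hI r hr) hrw).trans ih

lemma derivedLanguage_le {I : g.NT → Language T}
    (hI : ∀ r ∈ g.rules, stringLanguage I r.output ≤ I r.input) (A : g.NT) :
    derivedLanguage g A ≤ I A := by
  intro w hw
  have h := stringLanguage_le_of_derives hI hw
  simp only [stringLanguage_map_terminal, stringLanguage_cons, stringLanguage_nil, mul_one] at h
  exact h rfl

lemma derives_of_mem_stringLanguage {s : List (Symbol T g.NT)} {w : List T}
    (hw : w ∈ stringLanguage (derivedLanguage g) s) : g.Derives s (w.map .terminal) := by
  induction s generalizing w with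
  | nil => cases hw; exact .refl _
  | cons X s ih =>
    obtain ⟨u, hu, v, hv, rfl⟩ := hw
    have huX : g.Derives [X] (u.map .terminal) := by
      cases X with
      | terminal x => cases hu; exact .refl _
      | nonterminal A => exact hu
    simpa using (huX.append_right s).trans ((ih hv).append_left _)

lemma stringLanguage_derivedLanguage_le {r : ContextFreeRule T g.NT} (hr : r ∈ g.rules) :
    stringLanguage (derivedLanguage g) r.output ≤ derivedLanguage g r.input := fun _ hw ↦
  (Produces.single ⟨r, hr, .input_output⟩).trans (derives_of_mem_stringLanguage hw)

end DerivedLanguage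

section NeOrNe

/-- Nonterminals of a grammar for `neOrNeLanguage a b c`. With `e = ![a, b, c]`, the nonterminal
`letter i` stands for the words `eᵢⁿ`, and `unequal i` for the words `eᵢⁿ eᵢ₊₁ᵐ` with `n ≠ m`. -/
inductive NeOrNeNT
  | start
  | letter (i : Fin 3)
  | unequal (i : Fin 2)

variable {T : Type*}

open Classical in
/-- The rules of a grammar for `neOrNeLanguage (e 0) (e 1) (e 2)`. -/
noncomputable def neOrNeRules (e : Fin 3 → T) : Finset (ContextFreeRule T NeOrNeNT) :=
  {⟨.start, [.nonterminal (.unequal 0), .nonterminal (.letter 2)]⟩,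
    ⟨.start, [.nonterminal (.letter 0), .nonterminal (.unequal 1)]⟩} ∪
  (Finset.univ.biUnion fun i : Fin 3 ↦
    {⟨.letter i, []⟩, ⟨.letter i, [.terminal (e i), .nonterminal (.letter i)]⟩}) ∪
  (Finset.univ.biUnion fun i : Fin 2 ↦
    {⟨.unequal i, [.terminal (e i.castSucc), .nonterminal (.letter i.castSucc)]⟩,
      ⟨.unequal i, [.terminal (e i.succ), .nonterminal (.letter i.succ)]⟩,
      ⟨.unequal i, [.terminal (e i.castSucc), .nonterminal (.unequal i), .terminal (e i.succ)]⟩})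

lemma forall_mem_neOrNeRules_iff {e : Fin 3 → T} {I : NeOrNeNT → Language T} :
    (∀ r ∈ neOrNeRules e, stringLanguage I r.output ≤ I r.input) ↔
      (I (.unequal 0) * I (.letter 2) ≤ I .start ∧ I (.letter 0) * I (.unequal 1) ≤ I .start) ∧
      (∀ i, 1 ≤ I (.letter i) ∧ {[e i]} * I (.letter i) ≤ I (.letter i)) ∧
      ∀ i : Fin 2, {[e i.castSucc]} * I (.letter i.castSucc) ≤ I (.unequal i) ∧
        {[e i.succ]} * I (.letter i.succ) ≤ I (.unequal i) ∧
        {[e i.castSucc]} * (I (.unequal i) * {[e i.succ]}) ≤ I (.unequal i) := by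
  simp only [neOrNeRules, Finset.mem_union, Finset.mem_insert, Finset.mem_singleton,
    Finset.mem_biUnion, Finset.mem_univ, true_and, or_imp, forall_and, forall_exists_index,
    forall_eq_apply_imp_iff, forall_eq, stringLanguage_cons, stringLanguage_nil, symbolLanguage,
    mul_one]
  tauto

/-- The language of the words `xⁿ yᵐ` with `n ≠ m`. -/
def unequalLanguage (x y : T) : Language T :=
  {w | ∃ n m : ℕ, n ≠ m ∧ w = List.replicate n x ++ List.replicate m y}

/-- The languages described by the nonterminals of the grammar. -/
def neOrNeSolution (e : Fin 3 → T) : NeOrNeNT → Language T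
  | .start => neOrNeLanguage (e 0) (e 1) (e 2)
  | .letter i => {w | ∃ n, w = List.replicate n (e i)}
  | .unequal i => unequalLanguage (e i.castSucc) (e i.succ)

lemma stringLanguage_neOrNeSolution_le (e : Fin 3 → T) :
    ∀ r ∈ neOrNeRules e,
      stringLanguage (neOrNeSolution e) r.output ≤ neOrNeSolution e r.input := by
  refine forall_mem_neOrNeRules_iff.2 ⟨⟨?_, ?_⟩, fun i ↦ ⟨?_, ?_⟩, fun i ↦ ⟨?_, ?_, ?_⟩⟩
  · rintro _ ⟨_, ⟨n, m, hnm, rfl⟩, _, ⟨l, rfl⟩, rfl⟩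
    exact ⟨n, m, l, .inl hnm, rfl⟩
  · rintro _ ⟨_, ⟨n, rfl⟩, _, ⟨m, l, hml, rfl⟩, rfl⟩
    exact ⟨n, m, l, .inr hml, (List.append_assoc ..).symm⟩
  · rintro _ ⟨⟩
    exact ⟨0, rfl⟩
  · rintro _ ⟨_, ⟨⟩, _, ⟨n, rfl⟩, rfl⟩
    exact ⟨n + 1, rfl⟩
  · rintro _ ⟨_, ⟨⟩, _, ⟨n, rfl⟩, rfl⟩
    exact ⟨n + 1, 0, n.succ_ne_zero, by simp [List.replicate_succ]⟩
  · rintro _ ⟨_, ⟨⟩, _, ⟨n, rfl⟩, rfl⟩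
    exact ⟨0, n + 1, n.succ_ne_zero.symm, rfl⟩
  · rintro _ ⟨_, ⟨⟩, _, ⟨_, ⟨n, m, hnm, rfl⟩, _, ⟨⟩, rfl⟩, rfl⟩
    exact ⟨n + 1, m + 1, by simpa, by simp [List.replicate_succ, ← List.replicate_succ']⟩

lemma replicate_append_replicate_mem_of_ne {x y : T} {U : Language T}
    (hx : ∀ n, List.replicate (n + 1) x ∈ U) (hy : ∀ n, List.replicate (n + 1) y ∈ U)
    (hxy : {[x]} * (U * {[y]}) ≤ U) {n m : ℕ} (hnm : n ≠ m) :
    List.replicate n x ++ List.replicate m y ∈ U := by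
  induction n generalizing m with
  | zero => obtain ⟨m, rfl⟩ := Nat.exists_eq_succ_of_ne_zero hnm.symm; simpa using hy m
  | succ n ih =>
    obtain _ | m := m
    · simpa using hx n
    · have hword : List.replicate (n + 1) x ++ List.replicate (m + 1) y =
          [x] ++ (List.replicate n x ++ List.replicate m y ++ [y]) := by
        rw [List.replicate_succ, List.replicate_succ', List.append_assoc]; rfl
      exact hword ▸ hxy ⟨[x], rfl, _, ⟨_, ih (m := m) (by omega), [y], rfl, rfl⟩, rfl⟩

lemma neOrNeLanguage_le {e : Fin 3 → T} {I : NeOrNeNT → Language T}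
    (hI : ∀ r ∈ neOrNeRules e, stringLanguage I r.output ≤ I r.input) :
    neOrNeLanguage (e 0) (e 1) (e 2) ≤ I .start := by
  obtain ⟨⟨hstart₀, hstart₁⟩, hletter, hunequal⟩ := forall_mem_neOrNeRules_iff.1 hI
  have replicate_mem (i n) : List.replicate n (e i) ∈ I (.letter i) := by
    induction n with
    | zero => exact (hletter i).1 rfl
    | succ n ih => exact (hletter i).2 ⟨[e i], rfl, _, ih, rfl⟩
  have unequal_mem (i : Fin 2) {n m : ℕ} (hnm : n ≠ m) :
      List.replicate n (e i.castSucc) ++ List.replicate m (e i.succ) ∈ I (.unequal i) :=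
    replicate_append_replicate_mem_of_ne
      (fun n ↦ (hunequal i).1 ⟨[e i.castSucc], rfl, _, replicate_mem _ n, rfl⟩)
      (fun n ↦ (hunequal i).2.1 ⟨[e i.succ], rfl, _, replicate_mem _ n, rfl⟩)
      (hunequal i).2.2 hnm
  rintro _ ⟨n, m, l, hnm | hml, rfl⟩
  · exact hstart₀ ⟨_, unequal_mem 0 hnm, _, replicate_mem 2 l, rfl⟩
  · exact hstart₁ ⟨_, replicate_mem 0 n, _, unequal_mem 1 hml, (List.append_assoc ..).symm⟩

lemma isContextFree_neOrNeLanguage (a b c : T) : (neOrNeLanguage a b c).IsContextFree := by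
  let g : ContextFreeGrammar T := ⟨NeOrNeNT, .start, neOrNeRules ![a, b, c]⟩
  refine ⟨g, le_antisymm (α := Language T) ?_ ?_⟩
  · exact derivedLanguage_le (g := g) (stringLanguage_neOrNeSolution_le _) .start
  · exact neOrNeLanguage_le (e := ![a, b, c]) (I := derivedLanguage g)
      fun _ ↦ stringLanguage_derivedLanguage_le (g := g)

end NeOrNe

section ParseForests

variable {T : Type*} {g : ContextFreeGrammar T} {X : Symbol T g.NT} {s : List (Symbol T g.NT)}
  {A : g.NT}

/-- The rules for the nonterminal `A` that occur at the roots of parse trees: those whose right-hand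
side has a sequence of parse trees. -/
abbrev ProductiveRule (A : g.NT) : Type _ :=
  {r : ContextFreeRule T g.NT // r ∈ g.rules ∧ r.input = A ∧ Nonempty (g.ParseForest r.output)}

namespace ParseForest

/-- A nonempty sequence of parse trees is its first tree together with the other ones. -/
def consEquiv : g.ParseForest [X] × g.ParseForest s ≃ g.ParseForest (X :: s) where
  toFun
    | ⟨.leaf x .nil, f⟩ => .leaf x f
    | ⟨.node r hr ch .nil, f⟩ => .node r hr ch f
  invFun
    | .leaf x f => ⟨.leaf x .nil, f⟩
    | .node r hr ch f => ⟨.node r hr ch .nil, f⟩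
  left_inv
    | ⟨.leaf _ .nil, _⟩ => rfl
    | ⟨.node _ _ _ .nil, _⟩ => rfl
  right_inv
    | .leaf _ _ => rfl
    | .node _ _ _ _ => rfl

lemma yield_consEquiv :
    ∀ p : g.ParseForest [X] × g.ParseForest s, (consEquiv p).yield = p.1.yield ++ p.2.yield
  | ⟨.leaf _ .nil, _⟩ => rfl
  | ⟨.node _ _ ch .nil, f⟩ => congrArg (· ++ f.yield) (List.append_nil ch.yield).symm

/-- A parse tree as a nonterminal is a productive rule for it together with the sequence of
subtrees. -/
def nodeEquiv :
    (Σ r : ProductiveRule A, g.ParseForest r.1.output) ≃ g.ParseForest [.nonterminal A] where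
  toFun
    | ⟨⟨r, hr⟩, ch⟩ => hr.2.1 ▸ .node r hr.1 ch .nil
  invFun
    | .node r hr ch .nil => ⟨⟨r, hr, rfl, ⟨ch⟩⟩, ch⟩
  left_inv := by rintro ⟨⟨r, hr, rfl, _⟩, ch⟩; rfl
  right_inv
    | .node _ _ _ .nil => rfl

lemma yield_nodeEquiv (p : Σ r : ProductiveRule A, g.ParseForest r.1.output) :
    (nodeEquiv p).yield = p.2.yield := by
  obtain ⟨⟨r, hr, rfl, _⟩, ch⟩ := p
  exact List.append_nil _

/-- The number of nodes that are labelled by rules. -/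
def size : {s : List (Symbol T g.NT)} → g.ParseForest s → ℕ
  | _, .nil => 0
  | _, .leaf _ rest => size rest
  | _, .node _ _ children rest => size children + size rest + 1

lemma size_consEquiv :
    ∀ p : g.ParseForest [X] × g.ParseForest s, size (consEquiv p) = size p.1 + size p.2
  | ⟨.leaf _ .nil, f⟩ => (Nat.zero_add (size f)).symm
  | ⟨.node _ _ _ .nil, _⟩ => Nat.add_right_comm ..

lemma size_nodeEquiv (p : Σ r : ProductiveRule A, g.ParseForest r.1.output) :
    size (nodeEquiv p) = size p.2 + 1 := by
  obtain ⟨⟨r, hr, rfl, _⟩, ch⟩ := p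
  rfl

lemma yield_mem_stringLanguage {I : g.NT → Language T}
    (hI : ∀ r ∈ g.rules, stringLanguage I r.output ≤ I r.input) (f : g.ParseForest s) :
    f.yield ∈ stringLanguage I s := by
  induction f with
  | nil => exact rfl
  | leaf x f ih => exact ⟨[x], rfl, _, ih, rfl⟩
  | node r hr ch f ihc ihf => exact ⟨_, hI r hr ihc, _, ihf, rfl⟩

lemma exists_yield_eq_of_mem_stringLanguage {w : List T}
    (hw : w ∈ stringLanguage (fun A ↦ {w | Nonempty (g.ParseTree A w)}) s) :
    ∃ f : g.ParseForest s, f.yield = w := by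
  induction s generalizing w with
  | nil => exact ⟨.nil, (show w = [] from hw).symm⟩
  | cons X s ih =>
    obtain ⟨u, hu, v, hv, rfl⟩ := hw
    obtain ⟨f, rfl⟩ := ih hv
    cases X with
    | terminal x => cases hu; exact ⟨.leaf x f, rfl⟩
    | nonterminal A => obtain ⟨t, rfl⟩ := hu; exact ⟨consEquiv ⟨t, f⟩, yield_consEquiv _⟩

end ParseForest

lemma mem_language_iff_nonempty_parseTree {w : List T} :
    w ∈ g.language ↔ Nonempty (g.ParseTree g.initial w) := by
  constructor
  · refine fun hw ↦ derivedLanguage_le (I := fun A ↦ {w | Nonempty (g.ParseTree A w)})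
      (fun r hr w hw ↦ ?_) g.initial hw
    obtain ⟨f, rfl⟩ := ParseForest.exists_yield_eq_of_mem_stringLanguage hw
    exact ⟨ParseForest.nodeEquiv ⟨⟨r, hr, rfl, ⟨f⟩⟩, f⟩, ParseForest.yield_nodeEquiv _⟩
  · rintro ⟨t, rfl⟩
    have ht := ParseForest.yield_mem_stringLanguage (fun _ ↦ stringLanguage_derivedLanguage_le) t
    rwa [stringLanguage_cons, stringLanguage_nil, mul_one] at ht

/-- An unambiguous grammar, as a GF(2)-grammar. -/
def GF2Grammar.ofIsUnambiguous (g : ContextFreeGrammar T) (hg : g.IsUnambiguous) :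
    GF2Grammar T where
  toCFG := g
  finite_parseTree w := have := hg w; inferInstance

lemma GF2Grammar.language_ofIsUnambiguous (hg : g.IsUnambiguous) :
    (GF2Grammar.ofIsUnambiguous g hg).language = g.language := by
  ext w
  have := hg w
  change Odd (Nat.card (g.ParseTree g.initial w)) ↔ _
  rw [mem_language_iff_nonempty_parseTree]
  rcases isEmpty_or_nonempty (g.ParseTree g.initial w) with hw | hw
  · simpa using hw
  · simpa [Nat.card_of_subsingleton hw.some] using hw

end ParseForests

section SortedWords

variable {T ι : Type*} [LinearOrder ι] {e : ι → T} {p q : ι} {d : ι →₀ ℕ}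

/-- The word with nondecreasing letters `e i` in which the index `i` occurs `d i` times. -/
noncomputable def sortedWord (e : ι → T) (d : ι →₀ ℕ) : List T :=
  ((Finsupp.toMultiset d).sort (· ≤ ·)).map e

lemma sortedWord_injective (he : Function.Injective e) : Function.Injective (sortedWord e) := by
  intro d d' h
  rw [← Finsupp.toMultiset_toFinsupp d, ← Multiset.sort_eq (Finsupp.toMultiset d) (· ≤ ·),
    List.map_injective_iff.2 he h, Multiset.sort_eq, Finsupp.toMultiset_toFinsupp]

/-- `SortedRun e p w q d` says that `w` is a word in the letters `e i` with nondecreasing indices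
`i ≥ p`, that `q` is the last index (`p` if `w` is empty), and that each index `i` occurs `d i`
times. It is a run of the automaton whose states are the indices and which moves to `i ≥ p` from
`p` when it reads `e i`. -/
inductive SortedRun (e : ι → T) : ι → List T → ι → (ι →₀ ℕ) → Prop
  | nil (p : ι) : SortedRun e p [] p 0
  | cons {p i q : ι} {w : List T} {d : ι →₀ ℕ} (hpi : p ≤ i) (h : SortedRun e i w q d) :
      SortedRun e p (e i :: w) q (Finsupp.single i 1 + d)

namespace SortedRun

lemma le {w : List T} (h : SortedRun e p w q d) : p ≤ q := by
  induction h with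
  | nil => exact le_rfl
  | cons hpi _ ih => exact hpi.trans ih

lemma le_of_mem_support {w : List T} (h : SortedRun e p w q d) {j : ι} (hj : j ∈ d.support) :
    p ≤ j := by
  induction h with
  | nil => simp at hj
  | cons hpi _ ih =>
    rcases Finset.mem_union.1 (Finsupp.support_add hj) with hj | hj
    · exact hpi.trans_eq (Finset.mem_singleton.1 (Finsupp.support_single_subset hj)).symm
    · exact hpi.trans (ih hj)

lemma append {r : ι} {u v : List T} {d₁ d₂ : ι →₀ ℕ} (hu : SortedRun e p u r d₁)
    (hv : SortedRun e r v q d₂) : SortedRun e p (u ++ v) q (d₁ + d₂) := by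
  induction hu with
  | nil => simpa using hv
  | cons hpi _ ih => rw [add_assoc]; exact .cons hpi (ih hv)

lemma exists_of_append {u v : List T} (h : SortedRun e p (u ++ v) q d) :
    ∃ r d₁ d₂, SortedRun e p u r d₁ ∧ SortedRun e r v q d₂ ∧ d₁ + d₂ = d := by
  induction u generalizing p d with
  | nil => exact ⟨p, 0, d, .nil p, h, zero_add d⟩
  | cons x u ih =>
    cases h with
    | cons hpi h =>
      obtain ⟨r, d₁, d₂, hu, hv, rfl⟩ := ih h
      exact ⟨r, _, d₂, .cons hpi hu, hv, add_assoc ..⟩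

lemma nil_iff : SortedRun e p [] q d ↔ p = q ∧ d = 0 := by
  constructor
  · rintro ⟨⟩
    exact ⟨rfl, rfl⟩
  · rintro ⟨rfl, rfl⟩
    exact .nil p

lemma cons_iff (he : Function.Injective e) {i : ι} {w : List T} :
    SortedRun e p (e i :: w) q d ↔
      p ≤ i ∧ ∃ d', SortedRun e i w q d' ∧ d = Finsupp.single i 1 + d' := by
  constructor
  · intro h
    generalize hx : e i = x at h
    cases h with
    | cons hpi h => obtain rfl := he hx; exact ⟨hpi, _, h, rfl⟩
  · rintro ⟨hpi, d', h, rfl⟩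
    exact .cons hpi h

lemma singleton_iff (he : Function.Injective e) {i : ι} :
    SortedRun e p [e i] q d ↔ p ≤ q ∧ i = q ∧ d = Finsupp.single q 1 := by
  rw [cons_iff he]
  constructor
  · rintro ⟨hpi, d', h, rfl⟩
    obtain ⟨rfl, rfl⟩ := nil_iff.1 h
    exact ⟨hpi, rfl, add_zero _⟩
  · rintro ⟨hpq, rfl, rfl⟩
    exact ⟨hpq, 0, .nil i, (add_zero _).symm⟩

lemma unique (he : Function.Injective e) {w : List T} {q' : ι} {d' : ι →₀ ℕ}
    (h : SortedRun e p w q d) (h' : SortedRun e p w q' d') : q = q' ∧ d = d' := by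
  induction h generalizing d' with
  | nil => exact ⟨(nil_iff.1 h').1, (nil_iff.1 h').2.symm⟩
  | cons _ _ ih =>
    obtain ⟨-, d'', h'', rfl⟩ := (cons_iff he).1 h'
    obtain ⟨rfl, rfl⟩ := ih h''
    exact ⟨rfl, rfl⟩

lemma eq_sortedWord {w : List T} (h : SortedRun e p w q d) : w = sortedWord e d := by
  induction h with
  | nil => simp [sortedWord]
  | @cons _ i _ _ d _ h ih =>
    have hmin : ∀ j ∈ Finsupp.toMultiset d, i ≤ j := fun j hj ↦
      h.le_of_mem_support ((Finsupp.mem_toMultiset d j).1 hj)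
    rw [sortedWord, map_add, Finsupp.toMultiset_single, one_nsmul, Multiset.singleton_add,
      Multiset.sort_cons _ _ _ hmin, List.map_cons, ← sortedWord, ← ih]

end SortedRun

lemma exists_sortedRun_map {l : List ι} (hl : (p :: l).Pairwise (· ≤ ·)) :
    ∃ q, SortedRun e p (l.map e) q (Multiset.toFinsupp l) := by
  induction l generalizing p with
  | nil => exact ⟨p, by simpa using SortedRun.nil p⟩
  | cons i l ih =>
    obtain ⟨q, h⟩ := ih hl.of_cons
    refine ⟨q, ?_⟩
    rw [← Multiset.cons_coe, ← Multiset.singleton_add, map_add, Multiset.toFinsupp_singleton]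
    exact .cons (List.rel_of_pairwise_cons hl List.mem_cons_self) h

lemma exists_sortedRun_sortedWord (e : ι → T) (hp : ∀ i, p ≤ i) (d : ι →₀ ℕ) :
    ∃ q, SortedRun e p (sortedWord e d) q d := by
  have hsorted : (p :: (Finsupp.toMultiset d).sort (· ≤ ·)).Pairwise (· ≤ ·) :=
    List.pairwise_cons.2 ⟨fun i _ ↦ hp i, Multiset.pairwise_sort _ _⟩
  obtain ⟨q, h⟩ := exists_sortedRun_map (e := e) hsorted
  exact ⟨q, by simpa [sortedWord] using h⟩

end SortedWords

lemma sortedWord_fin_three {T : Type*} (e : Fin 3 → T) (d : Fin 3 →₀ ℕ) :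
    sortedWord e d =
      List.replicate (d 0) (e 0) ++ List.replicate (d 1) (e 1) ++ List.replicate (d 2) (e 2) := by
  have hsorted : (List.replicate (d 0) (0 : Fin 3) ++ List.replicate (d 1) 1 ++
      List.replicate (d 2) 2).Pairwise (· ≤ ·) := by
    simp only [List.pairwise_append, List.pairwise_replicate, List.mem_append, List.mem_replicate]
    grind
  have hcoe : ((List.replicate (d 0) (0 : Fin 3) ++ List.replicate (d 1) 1 ++
      List.replicate (d 2) 2 : List (Fin 3)) : Multiset (Fin 3)) = Finsupp.toMultiset d := by
    ext i
    fin_cases i <;> simp [List.count_replicate]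
  rw [sortedWord, ← hcoe, Multiset.coe_sort, List.mergeSort_of_pairwise (by simpa using hsorted)]
  simp

lemma sortedWord_mem_neOrNeLanguage_iff {T : Type*} {e : Fin 3 → T} (he : Function.Injective e)
    (d : Fin 3 →₀ ℕ) :
    sortedWord e d ∈ neOrNeLanguage (e 0) (e 1) (e 2) ↔ ∃ i j, d i ≠ d j := by
  constructor
  · rintro ⟨n, m, l, h, hw⟩
    obtain rfl : d = Finsupp.equivFunOnFinite.symm ![n, m, l] :=
      sortedWord_injective he (hw.trans
        (sortedWord_fin_three e (Finsupp.equivFunOnFinite.symm ![n, m, l])).symm)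
    exact h.elim (fun hnm ↦ ⟨0, 1, hnm⟩) (fun hml ↦ ⟨1, 2, hml⟩)
  · rintro ⟨i, j, hij⟩
    refine ⟨d 0, d 1, d 2, ?_, sortedWord_fin_three e d⟩
    by_contra! h
    fin_cases i <;> fin_cases j <;> simp_all

section FinitelyParsable

variable {T : Type*} {g : ContextFreeGrammar T} {X : Symbol T g.NT} {s : List (Symbol T g.NT)}

/-- A string of symbols is finitely parsable if it has a sequence of parse trees, and only finitely
many of them have the same yield. -/
structure IsFinitelyParsable (g : ContextFreeGrammar T) (s : List (Symbol T g.NT)) : Prop where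
  nonempty : Nonempty (g.ParseForest s)
  finite (w : List T) : Finite {f : g.ParseForest s // f.yield = w}

namespace IsFinitelyParsable

open ParseForest

lemma head (h : IsFinitelyParsable g (X :: s)) : IsFinitelyParsable g [X] := by
  obtain ⟨t₀, f₀⟩ := consEquiv.symm h.nonempty.some
  refine ⟨⟨t₀⟩, fun w ↦ ?_⟩
  have := h.finite (w ++ f₀.yield)
  refine Finite.of_injective
    (β := {f : g.ParseForest (X :: s) // f.yield = w ++ f₀.yield})
    (fun t ↦ ⟨consEquiv ⟨t.1, f₀⟩, by rw [yield_consEquiv, t.2]⟩) fun t t' htt' ↦ ?_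
  exact Subtype.ext (Prod.ext_iff.1 (consEquiv.injective (Subtype.ext_iff.1 htt'))).1

lemma tail (h : IsFinitelyParsable g (X :: s)) : IsFinitelyParsable g s := by
  obtain ⟨t₀, f₀⟩ := consEquiv.symm h.nonempty.some
  refine ⟨⟨f₀⟩, fun w ↦ ?_⟩
  have := h.finite (t₀.yield ++ w)
  refine Finite.of_injective
    (β := {f : g.ParseForest (X :: s) // f.yield = t₀.yield ++ w})
    (fun f ↦ ⟨consEquiv ⟨t₀, f.1⟩, by rw [yield_consEquiv, f.2]⟩) fun f f' hff' ↦ ?_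
  exact Subtype.ext (Prod.ext_iff.1 (consEquiv.injective (Subtype.ext_iff.1 hff'))).2

lemma output {A : g.NT} (h : IsFinitelyParsable g [.nonterminal A]) (r : ProductiveRule A) :
    IsFinitelyParsable g r.1.output := by
  refine ⟨r.2.2.2, fun w ↦ ?_⟩
  have := h.finite w
  refine Finite.of_injective (β := {f : g.ParseForest [.nonterminal A] // f.yield = w})
    (fun f ↦ ⟨nodeEquiv ⟨r, f.1⟩, by rw [yield_nodeEquiv, f.2]⟩) fun f f' hff' ↦ ?_
  exact Subtype.ext (eq_of_heq (Sigma.mk.inj (nodeEquiv.injective (Subtype.ext_iff.1 hff'))).2)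

end IsFinitelyParsable

instance finite_productiveRule (A : g.NT) : Finite (ProductiveRule A) :=
  (g.rules.finite_toSet.subset fun _ hr ↦ hr.1).to_subtype

noncomputable instance fintypeProductiveRule (A : g.NT) : Fintype (ProductiveRule A) :=
  Fintype.ofFinite _

/-- The nonterminals that are finitely parsable. -/
abbrev FinitelyParsableNT (g : ContextFreeGrammar T) : Type :=
  {A : g.NT // IsFinitelyParsable g [.nonterminal A]}

instance finite_finitelyParsableNT : Finite (FinitelyParsableNT g) := by
  refine ((g.rules.finite_toSet.image (·.input)).subset fun A hA ↦ ?_).to_subtype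
  obtain ⟨r, -⟩ := ParseForest.nodeEquiv.symm (IsFinitelyParsable.nonempty hA).some
  exact ⟨r.1, r.2.1, r.2.2.1⟩

end FinitelyParsable

section CountMatrix

open Finset ParseForest

variable {T ι : Type*} [LinearOrder ι] {g : ContextFreeGrammar T} {X : Symbol T g.NT}
  {s : List (Symbol T g.NT)} {e : ι → T} {p q : ι} {d : ι →₀ ℕ}

/-- The sequences of parse trees whose yields are sorted words that lead from `p` to `q` and have
`d i` letters `e i`. -/
abbrev SortedForest (e : ι → T) (p q : ι) (s : List (Symbol T g.NT)) (d : ι →₀ ℕ) : Type _ :=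
  {f : g.ParseForest s // SortedRun e p f.yield q d}

lemma IsFinitelyParsable.finite_sortedForest (h : IsFinitelyParsable g s) (e : ι → T) (p q : ι)
    (d : ι →₀ ℕ) : Finite (SortedForest e p q s d) := by
  have := h.finite (sortedWord e d)
  exact Finite.of_injective (β := {f : g.ParseForest s // f.yield = sortedWord e d})
    (Subtype.map id fun _ hf ↦ hf.eq_sortedWord) (Subtype.map_injective _ Function.injective_id)

/-- A sorted run on the yield of a nonempty sequence splits at the yield of its first tree. -/
noncomputable def sortedForestConsEquiv (he : Function.Injective e) :
    (Σ i : ι × antidiagonal d, SortedForest e p i.1 [X] i.2.1.1 × SortedForest e i.1 q s i.2.1.2) ≃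
      SortedForest e p q (X :: s) d := by
  refine Equiv.ofBijective (fun x ↦ ⟨consEquiv ⟨x.2.1.1, x.2.2.1⟩, ?_⟩) ⟨?_, ?_⟩
  · have hx := x.2.1.2.append x.2.2.2
    rwa [mem_antidiagonal.1 x.1.2.2, ← yield_consEquiv (x.2.1.1, x.2.2.1)] at hx
  · rintro ⟨⟨r, ⟨d₁, d₂⟩, hd⟩, ⟨t, ht⟩, f, hf⟩ ⟨⟨r', ⟨d₁', d₂'⟩, hd'⟩, ⟨t', ht'⟩, f', hf'⟩ h
    obtain ⟨rfl, rfl⟩ := Prod.mk.inj (consEquiv.injective (Subtype.ext_iff.1 h))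
    obtain ⟨rfl, rfl : d₁ = d₁'⟩ := ht.unique he ht'
    obtain rfl : d₂ = d₂' := (hf.unique he hf').2
    rfl
  · rintro ⟨f, hf⟩
    obtain ⟨⟨t, f⟩, rfl⟩ := consEquiv.surjective f
    rw [yield_consEquiv] at hf
    obtain ⟨r, d₁, d₂, ht, hf, hd⟩ := hf.exists_of_append
    exact ⟨⟨⟨r, ⟨d₁, d₂⟩, mem_antidiagonal.2 hd⟩, ⟨t, ht⟩, f, hf⟩, rfl⟩

/-- The parse trees as a nonterminal with a given sorted run, by the rule at the root. -/
noncomputable def sortedForestNodeEquiv (A : g.NT) :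
    (Σ r : ProductiveRule A, SortedForest e p q r.1.output d) ≃
      SortedForest e p q [.nonterminal A] d := by
  refine Equiv.ofBijective
    (fun x ↦ ⟨nodeEquiv ⟨x.1, x.2.1⟩, (yield_nodeEquiv _).symm ▸ x.2.2⟩) ⟨?_, ?_⟩
  · rintro ⟨r, f, hf⟩ ⟨r', f', hf'⟩ h
    obtain ⟨rfl, h⟩ := Sigma.mk.inj (nodeEquiv.injective (Subtype.ext_iff.1 h))
    obtain rfl := eq_of_heq h
    rfl
  · rintro ⟨f, hf⟩
    obtain ⟨⟨r, f⟩, rfl⟩ := nodeEquiv.surjective f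
    exact ⟨⟨r, f, yield_nodeEquiv ⟨r, f⟩ ▸ hf⟩, rfl⟩

variable (k : Type*) [CommRing k]

/-- The matrix of power series whose `(p, q)` entry counts, as elements of `k`, the sequences of
parse trees of `s` by the numbers of letters in their yields, for those yields that are sorted words
leading from `p` to `q`. -/
noncomputable def countMatrix (e : ι → T) (s : List (Symbol T g.NT)) :
    Matrix ι ι (MvPowerSeries ι k) :=
  fun p q d ↦ (Nat.card (SortedForest e p q s d) : k)

variable {k}

lemma coeff_countMatrix :
    MvPowerSeries.coeff d (countMatrix k e s p q) = (Nat.card (SortedForest e p q s d) : k) :=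
  rfl

lemma countMatrix_apply_eq_zero (hqp : q < p) : countMatrix k e s p q = 0 := by
  ext d
  have : IsEmpty (SortedForest e p q s d) := ⟨fun f ↦ hqp.not_ge f.2.le⟩
  simp [coeff_countMatrix]

lemma countMatrix_nil : countMatrix k e ([] : List (Symbol T g.NT)) = 1 := by
  ext p q d
  rw [coeff_countMatrix, Matrix.one_apply]
  by_cases h : p = q ∧ d = 0
  · have : Unique (SortedForest e p q ([] : List (Symbol T g.NT)) d) :=
      ⟨⟨⟨.nil, SortedRun.nil_iff.2 h⟩⟩, fun | ⟨.nil, _⟩ => rfl⟩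
    rw [Nat.card_unique, if_pos h.1, h.2]
    simp
  · have : IsEmpty (SortedForest e p q ([] : List (Symbol T g.NT)) d) :=
      ⟨fun | ⟨.nil, hf⟩ => h (SortedRun.nil_iff.1 hf)⟩
    rw [Nat.card_of_isEmpty]
    grind [MvPowerSeries.coeff_one]

lemma countMatrix_terminal (he : Function.Injective e) (x : T) :
    countMatrix k e ([.terminal x] : List (Symbol T g.NT)) p q = 0 ∨
      countMatrix k e ([.terminal x] : List (Symbol T g.NT)) p q = MvPowerSeries.X q := by
  by_cases h : p ≤ q ∧ x = e q
  · obtain ⟨hpq, rfl⟩ := h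
    right
    ext d
    rw [coeff_countMatrix, MvPowerSeries.coeff_X]
    split_ifs with hd
    · have : Unique (SortedForest e p q ([.terminal (e q)] : List (Symbol T g.NT)) d) :=
        ⟨⟨⟨.leaf _ .nil, (SortedRun.singleton_iff he).2 ⟨hpq, rfl, hd⟩⟩⟩,
          fun | ⟨.leaf _ .nil, _⟩ => rfl⟩
      simp
    · have : IsEmpty (SortedForest e p q ([.terminal (e q)] : List (Symbol T g.NT)) d) :=
        ⟨fun | ⟨.leaf _ .nil, hf⟩ => hd ((SortedRun.singleton_iff he).1 hf).2.2⟩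
      simp
  · left
    ext d
    have : IsEmpty (SortedForest e p q ([.terminal x] : List (Symbol T g.NT)) d) := by
      refine ⟨fun | ⟨.leaf _ .nil, (hf : SortedRun e p [x] q d)⟩ => h ?_⟩
      obtain - | ⟨hpi, hf⟩ := hf
      obtain ⟨rfl, -⟩ := SortedRun.nil_iff.1 hf
      exact ⟨hpi, rfl⟩
    simp [coeff_countMatrix]

lemma countMatrix_cons [Fintype ι] (he : Function.Injective e)
    (h : IsFinitelyParsable g (X :: s)) :
    countMatrix k e (X :: s) = countMatrix k e [X] * countMatrix k e s := by
  ext p q d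
  have hX := fun r d ↦ h.head.finite_sortedForest e p r d
  have hs := fun r d ↦ h.tail.finite_sortedForest e r q d
  rw [coeff_countMatrix, ← Nat.card_congr (sortedForestConsEquiv he), Nat.card_sigma,
    Fintype.sum_prod_type, Nat.cast_sum, Matrix.mul_apply, map_sum]
  refine sum_congr rfl fun r _ ↦ ?_
  rw [MvPowerSeries.coeff_mul, Nat.cast_sum, ← sum_coe_sort (antidiagonal d)]
  simp [Nat.card_prod, coeff_countMatrix]

lemma countMatrix_nonterminal {A : g.NT} (h : IsFinitelyParsable g [.nonterminal A]) :
    countMatrix k e [.nonterminal A] = ∑ r : ProductiveRule A, countMatrix k e r.1.output := by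
  ext p q d
  have hr := fun r : ProductiveRule A ↦ (h.output r).finite_sortedForest e p q d
  rw [coeff_countMatrix, ← Nat.card_congr (sortedForestNodeEquiv A), Nat.card_sigma, Nat.cast_sum,
    Matrix.sum_apply, map_sum]
  rfl

lemma coeff_sum_countMatrix [Fintype ι] (he : Function.Injective e) (hp : ∀ i, p ≤ i)
    (h : IsFinitelyParsable g s) :
    MvPowerSeries.coeff d (∑ q, countMatrix k e s p q) =
      (Nat.card {f : g.ParseForest s // f.yield = sortedWord e d} : k) := by
  have := fun q ↦ h.finite_sortedForest e p q d
  let toYield (x : Σ q, SortedForest e p q s d) :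
      {f : g.ParseForest s // f.yield = sortedWord e d} :=
    ⟨x.2.1, x.2.2.eq_sortedWord⟩
  have toYield_bijective : Function.Bijective toYield := by
    constructor
    · rintro ⟨q, f, hf⟩ ⟨q', f', hf'⟩ hff'
      obtain rfl : f = f' := Subtype.ext_iff.1 hff'
      obtain ⟨rfl, -⟩ := hf.unique he hf'
      rfl
    · rintro ⟨f, hf⟩
      obtain ⟨q, hq⟩ := exists_sortedRun_sortedWord e hp d
      exact ⟨⟨q, f, hf ▸ hq⟩, rfl⟩
  rw [← Nat.card_congr (Equiv.ofBijective toYield toYield_bijective), Nat.card_sigma, map_sum,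
    Nat.cast_sum]
  rfl

end CountMatrix

lemma det_one_sub_ne_zero_of_wellFounded {n R : Type*} [Fintype n] [DecidableEq n] [CommRing R]
    [IsDomain R] {r : n → n → Prop} (hr : WellFounded r) {M : Matrix n n R}
    (hM : ∀ i j, M i j ≠ 0 → r j i) : (1 - M).det ≠ 0 := by
  intro hdet
  obtain ⟨v, hv, hMv⟩ := Matrix.exists_mulVec_eq_zero_iff.2 hdet
  rw [Matrix.sub_mulVec, Matrix.one_mulVec, sub_eq_zero] at hMv
  refine hv (funext fun i ↦ hr.induction (C := fun i ↦ v i = 0) i fun i ih ↦ ?_)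
  rw [hMv, Matrix.mulVec, dotProduct]
  refine Finset.sum_eq_zero fun j _ ↦ ?_
  by_cases hij : M i j = 0
  · rw [hij, zero_mul]
  · rw [ih j (hM i j hij), mul_zero]

lemma mem_of_mulVec_mem {n K : Type*} [Fintype n] [DecidableEq n] [Field K] {E : Subfield K}
    {O : Subring K} (hE : E.toSubring ≤ O) {M : Matrix n n K} (hM : ∀ i j, M i j ∈ E)
    (hdet : M.det ≠ 0) {v : n → K} (hv : ∀ i, (M.mulVec v) i ∈ O) (i : n) : v i ∈ O := by
  let N : Matrix n n E := fun i j ↦ ⟨M i j, hM i j⟩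
  have hN : M = E.subtype.mapMatrix N := rfl
  have hNdet : IsUnit N.det := by
    rw [isUnit_iff_ne_zero]
    intro h
    rw [hN, ← RingHom.map_det, h, map_zero] at hdet
    exact hdet rfl
  have hinv : E.subtype.mapMatrix N⁻¹ * M = 1 := by
    rw [hN, ← map_mul, Matrix.nonsing_inv_mul N hNdet, map_one]
  rw [← Matrix.one_mulVec v, ← hinv, ← Matrix.mulVec_mulVec]
  exact sum_mem fun j _ ↦ O.mul_mem (hE (N⁻¹ i j).2) (hv j)

section LeibnizCoeff

open Classical in
/-- The coefficients in the Leibniz rule for lists: if `δ (x :: s) = u x * δ s + δ x * v s`, where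
`v` is extended multiplicatively to lists, then `δ s` is the sum of all
`leibnizCoeff u v s x * δ x`. -/
noncomputable def leibnizCoeff {α R : Type*} [CommSemiring R] (u v : α → R) : List α → α → R
  | [], _ => 0
  | x :: s, y => u x * leibnizCoeff u v s y + if x = y then (s.map v).prod else 0

lemma leibnizCoeff_cons_self {α R : Type*} [CommSemiring R] (u v : α → R) (s : List α) (x : α) :
    leibnizCoeff u v (x :: s) x = u x * leibnizCoeff u v s x + (s.map v).prod := by
  rw [leibnizCoeff, if_pos rfl]

lemma leibnizCoeff_cons_of_ne {α R : Type*} [CommSemiring R] (u v : α → R) (s : List α) {x y : α}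
    (h : x ≠ y) : leibnizCoeff u v (x :: s) y = u x * leibnizCoeff u v s y := by
  rw [leibnizCoeff, if_neg h, add_zero]

lemma map_leibnizCoeff {α R R' : Type*} [CommSemiring R] [CommSemiring R'] (φ : R →+* R')
    (u v : α → R) (s : List α) (y : α) :
    φ (leibnizCoeff u v s y) = leibnizCoeff (φ ∘ u) (φ ∘ v) s y := by
  induction s with
  | nil => exact map_zero φ
  | cons x s ih => simp [leibnizCoeff, ih, apply_ite φ, map_list_prod]

lemma leibnizCoeff_mem {α R S : Type*} [CommSemiring R] [SetLike S R] [SubsemiringClass S R]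
    {E : S} {u v : α → R} (hu : ∀ x, u x ∈ E) (hv : ∀ x, v x ∈ E) (s : List α) (y : α) :
    leibnizCoeff u v s y ∈ E := by
  induction s with
  | nil => exact zero_mem E
  | cons x s ih =>
    refine add_mem (mul_mem (hu x) ih) ?_
    split_ifs
    · exact list_prod_mem fun z hz ↦ by
        obtain ⟨x, -, rfl⟩ := List.mem_map.1 hz
        exact hv x
    · exact zero_mem E

lemma derivation_list_prod_eq_leibnizCoeff {α R B : Type*} [CommSemiring R] [CommSemiring B]
    [Algebra R B] (D : Derivation R B B) {u : α → B} {y : α} (hDy : D (u y) = 1)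
    (hD : ∀ x ≠ y, D (u x) = 0) (s : List α) : D (s.map u).prod = leibnizCoeff u u s y := by
  induction s with
  | nil => exact D.map_one_eq_zero
  | cons x s ih =>
    rw [List.map_cons, List.prod_cons, D.leibniz, ih, smul_eq_mul, smul_eq_mul]
    by_cases h : x = y
    · rw [h, hDy, mul_one, leibnizCoeff_cons_self]
    · rw [hD x h, mul_zero, add_zero, leibnizCoeff_cons_of_ne u u s h]

end LeibnizCoeff

section LeibnizMatrix

open ParseForest

variable {T : Type*} {g : ContextFreeGrammar T} {s : List (Symbol T g.NT)}

lemma exists_yield_eq_nil_of_prod_ne_zero {R : Type*} [CommSemiring R] {u : Symbol T g.NT → R}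
    (hu : ∀ X, u X ≠ 0 → ∃ t : g.ParseForest [X], t.yield = []) (h : (s.map u).prod ≠ 0) :
    ∃ f : g.ParseForest s, f.yield = [] := by
  induction s with
  | nil => exact ⟨.nil, rfl⟩
  | cons X s ih =>
    rw [List.map_cons, List.prod_cons] at h
    obtain ⟨t, ht⟩ := hu X (left_ne_zero_of_mul h)
    obtain ⟨f, hf⟩ := ih (right_ne_zero_of_mul h)
    exact ⟨consEquiv ⟨t, f⟩, by rw [yield_consEquiv, ht, hf, List.append_nil]⟩

lemma exists_yield_eq_of_leibnizCoeff_ne_zero {R : Type*} [CommSemiring R]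
    {u v : Symbol T g.NT → R} (hu : ∀ X, u X ≠ 0 → ∃ t : g.ParseForest [X], t.yield = [])
    (hv : ∀ X, v X ≠ 0 → ∃ t : g.ParseForest [X], t.yield = []) {Y : Symbol T g.NT}
    (h : leibnizCoeff u v s Y ≠ 0) (t : g.ParseForest [Y]) :
    ∃ f : g.ParseForest s, f.yield = t.yield ∧ size t ≤ size f := by
  induction s with
  | nil => exact absurd rfl h
  | cons X s ih =>
    rw [leibnizCoeff] at h
    by_cases hs : u X * leibnizCoeff u v s Y = 0
    · simp only [hs, zero_add, ne_eq, ite_eq_right_iff, Classical.not_imp] at h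
      obtain ⟨rfl, h⟩ := h
      obtain ⟨f, hf⟩ := exists_yield_eq_nil_of_prod_ne_zero hv h
      exact ⟨consEquiv ⟨t, f⟩, by rw [yield_consEquiv, hf, List.append_nil],
        by rw [size_consEquiv]; exact Nat.le_add_right _ _⟩
    · obtain ⟨t₀, ht₀⟩ := hu X (left_ne_zero_of_mul hs)
      obtain ⟨f, hf, hsize⟩ := ih (right_ne_zero_of_mul hs)
      exact ⟨consEquiv ⟨t₀, f⟩, by rw [yield_consEquiv, ht₀, hf, List.nil_append],
        by rw [size_consEquiv]; exact hsize.trans (Nat.le_add_left _ _)⟩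

/-- Every parse tree as `B` has the yield of some larger parse tree as `A`. -/
def Enlarges (B A : FinitelyParsableNT g) : Prop :=
  ∀ t : g.ParseForest [.nonterminal B.1], ∃ t' : g.ParseForest [.nonterminal A.1],
    t'.yield = t.yield ∧ size t < size t'

lemma not_enlarges_self (A : FinitelyParsableNT g) : ¬ Enlarges A A := by
  intro h
  obtain ⟨t⟩ := A.2.nonempty
  have := A.2.finite t.yield
  have : Nonempty {t' : g.ParseForest [.nonterminal A.1] // t'.yield = t.yield} := ⟨⟨t, rfl⟩⟩
  obtain ⟨⟨t', ht'⟩, hmax⟩ := Finite.exists_max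
    fun t' : {t' : g.ParseForest [.nonterminal A.1] // t'.yield = t.yield} ↦ size t'.1
  obtain ⟨t'', ht'', hlt⟩ := h t'
  exact hlt.not_ge (hmax ⟨t'', ht''.trans ht'⟩)

lemma wellFounded_enlarges : WellFounded (Enlarges (g := g)) := by
  have : IsTrans (FinitelyParsableNT g) Enlarges := ⟨fun A B C hAB hBC t ↦ by
    obtain ⟨t', ht', hlt⟩ := hAB t
    obtain ⟨t'', ht'', hlt'⟩ := hBC t'
    exact ⟨t'', ht''.trans ht', hlt.trans hlt'⟩⟩
  have : Std.Irrefl (Enlarges (g := g)) := ⟨not_enlarges_self⟩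
  exact Finite.wellFounded_of_trans_of_irrefl _

noncomputable instance fintypeFinitelyParsableNT : Fintype (FinitelyParsableNT g) :=
  Fintype.ofFinite _

noncomputable instance decidableEqFinitelyParsableNT : DecidableEq (FinitelyParsableNT g) :=
  Classical.decEq _

lemma sum_leibnizCoeff_cons_terminal {R : Type*} [CommSemiring R] (u v : Symbol T g.NT → R) (x : T)
    (f : FinitelyParsableNT g → R) :
    ∑ B : FinitelyParsableNT g, leibnizCoeff u v (.terminal x :: s) (.nonterminal B.1) * f B =
      u (.terminal x) *
        ∑ B : FinitelyParsableNT g, leibnizCoeff u v s (.nonterminal B.1) * f B := by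
  rw [Finset.mul_sum]
  exact Finset.sum_congr rfl fun B _ ↦ by
    rw [leibnizCoeff_cons_of_ne u v s (by simp), mul_assoc]

lemma sum_leibnizCoeff_cons_nonterminal {R : Type*} [CommSemiring R] (u v : Symbol T g.NT → R)
    (A : FinitelyParsableNT g) (f : FinitelyParsableNT g → R) :
    ∑ B : FinitelyParsableNT g, leibnizCoeff u v (.nonterminal A.1 :: s) (.nonterminal B.1) * f B =
      u (.nonterminal A.1) *
          ∑ B : FinitelyParsableNT g, leibnizCoeff u v s (.nonterminal B.1) * f B +
        (s.map v).prod * f A := by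
  have leibnizCoeff_cons (B : FinitelyParsableNT g) :
      leibnizCoeff u v (.nonterminal A.1 :: s) (.nonterminal B.1) * f B =
        u (.nonterminal A.1) * (leibnizCoeff u v s (.nonterminal B.1) * f B) +
          if A = B then (s.map v).prod * f B else 0 := by
    by_cases h : A = B
    · rw [← h, leibnizCoeff_cons_self, if_pos rfl, add_mul, mul_assoc]
    · have hAB : (.nonterminal A.1 : Symbol T g.NT) ≠ .nonterminal B.1 :=
        fun hAB ↦ h (Subtype.ext (Symbol.nonterminal.inj hAB))
      rw [leibnizCoeff_cons_of_ne u v s hAB, if_neg h, add_zero, mul_assoc]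
  rw [Finset.sum_congr rfl fun B _ ↦ leibnizCoeff_cons B, Finset.sum_add_distrib, Finset.mul_sum,
    Finset.sum_ite_eq, if_pos (Finset.mem_univ A)]

/-- The matrix of the linear system for the values `δ A` at nonterminals that arises from
`leibnizCoeff` if `δ A` is the sum of the values of `δ` at the right-hand sides of the rules
for `A`. -/
noncomputable def leibnizMatrix {R : Type*} [CommSemiring R] (u v : Symbol T g.NT → R) :
    Matrix (FinitelyParsableNT g) (FinitelyParsableNT g) R :=
  fun A B ↦ ∑ r : ProductiveRule A.1, leibnizCoeff u v r.1.output (.nonterminal B.1)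

lemma mapMatrix_leibnizMatrix {R R' : Type*} [CommSemiring R] [CommSemiring R'] (φ : R →+* R')
    (u v : Symbol T g.NT → R) :
    φ.mapMatrix (leibnizMatrix u v) = leibnizMatrix (φ ∘ u) (φ ∘ v) := by
  ext A B
  exact (map_sum φ _ _).trans (Finset.sum_congr rfl fun r _ ↦ map_leibnizCoeff φ u v _ _)

lemma enlarges_of_leibnizMatrix_ne_zero {R : Type*} [CommSemiring R] {u v : Symbol T g.NT → R}
    (hu : ∀ X, u X ≠ 0 → ∃ t : g.ParseForest [X], t.yield = [])
    (hv : ∀ X, v X ≠ 0 → ∃ t : g.ParseForest [X], t.yield = []) {A B : FinitelyParsableNT g}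
    (h : leibnizMatrix u v A B ≠ 0) : Enlarges B A := by
  intro t
  obtain ⟨r, -, hr⟩ := Finset.exists_ne_zero_of_sum_ne_zero h
  obtain ⟨f, hf, hsize⟩ := exists_yield_eq_of_leibnizCoeff_ne_zero hu hv hr t
  exact ⟨nodeEquiv ⟨r, f⟩, by rw [yield_nodeEquiv, hf],
    by rw [size_nodeEquiv]; exact Nat.lt_succ_of_le hsize⟩

lemma det_one_sub_leibnizMatrix_ne_zero {R : Type*} [CommRing R] [IsDomain R]
    {u v : Symbol T g.NT → R} (hu : ∀ X, u X ≠ 0 → ∃ t : g.ParseForest [X], t.yield = [])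
    (hv : ∀ X, v X ≠ 0 → ∃ t : g.ParseForest [X], t.yield = []) :
    (1 - leibnizMatrix u v).det ≠ 0 :=
  det_one_sub_ne_zero_of_wellFounded wellFounded_enlarges fun _ _ ↦
    enlarges_of_leibnizMatrix_ne_zero hu hv

variable {ι k : Type*} [LinearOrder ι] [CommRing k] {e : ι → T} {p q : ι}

open Classical in
/-- The diagonal entries of the matrices for the symbols that are finitely parsable, and zero for
the other symbols. -/
noncomputable def diagonalSeries (k : Type*) [CommRing k] (e : ι → T) (p : ι)
    (X : Symbol T g.NT) : MvPowerSeries ι k :=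
  if IsFinitelyParsable g [X] then countMatrix k e [X] p p else 0

lemma IsFinitelyParsable.diagonalSeries_eq {X : Symbol T g.NT} (h : IsFinitelyParsable g [X]) :
    diagonalSeries k e p X = countMatrix k e [X] p p :=
  if_pos h

lemma diagonalSeries_eq_zero {X : Symbol T g.NT} (h : ¬ IsFinitelyParsable g [X]) :
    diagonalSeries k e p X = 0 :=
  if_neg h

lemma diagonalSeries_terminal (he : Function.Injective e) (x : T) :
    diagonalSeries k e p (.terminal x : Symbol T g.NT) = 0 ∨
      diagonalSeries k e p (.terminal x : Symbol T g.NT) = MvPowerSeries.X p := by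
  by_cases h : IsFinitelyParsable g [.terminal x]
  · rw [h.diagonalSeries_eq]
    exact countMatrix_terminal he x
  · exact .inl (diagonalSeries_eq_zero h)

lemma exists_yield_eq_nil_of_constantCoeff_ne_zero {X : Symbol T g.NT}
    (h : MvPowerSeries.constantCoeff (diagonalSeries k e p X) ≠ 0) :
    ∃ t : g.ParseForest [X], t.yield = [] := by
  contrapose! h
  have : IsEmpty (SortedForest e p p [X] 0) :=
    ⟨fun t ↦ h t.1 (by simpa [sortedWord] using t.2.eq_sortedWord)⟩
  by_cases hX : IsFinitelyParsable g [X]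
  · rw [← MvPowerSeries.coeff_zero_eq_constantCoeff_apply, hX.diagonalSeries_eq, coeff_countMatrix,
      Nat.card_of_isEmpty, Nat.cast_zero]
  · rw [diagonalSeries_eq_zero hX, map_zero]

lemma det_one_sub_leibnizMatrix_diagonalSeries_ne_zero [IsDomain k] (e : ι → T) (p q : ι) :
    (1 - leibnizMatrix (diagonalSeries (g := g) k e p) (diagonalSeries k e q)).det ≠ 0 := by
  intro h
  have h' := congrArg MvPowerSeries.constantCoeff h
  rw [RingHom.map_det, map_sub, map_one, mapMatrix_leibnizMatrix, map_zero] at h'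
  exact det_one_sub_leibnizMatrix_ne_zero (fun _ ↦ exists_yield_eq_nil_of_constantCoeff_ne_zero)
    (fun _ ↦ exists_yield_eq_nil_of_constantCoeff_ne_zero) h'

lemma countMatrix_cons_self [Finite ι] (he : Function.Injective e) {X : Symbol T g.NT}
    (h : IsFinitelyParsable g (X :: s)) :
    countMatrix k e (X :: s) p p = diagonalSeries k e p X * countMatrix k e s p p := by
  have := Fintype.ofFinite ι
  rw [countMatrix_cons he h, h.head.diagonalSeries_eq, Matrix.mul_apply]
  refine Fintype.sum_eq_single p fun r hr ↦ ?_
  rcases hr.lt_or_gt with hrp | hpr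
  · rw [countMatrix_apply_eq_zero hrp, zero_mul]
  · rw [countMatrix_apply_eq_zero (p := r) hpr, mul_zero]

lemma countMatrix_self_eq_prod [Finite ι] (he : Function.Injective e)
    (h : IsFinitelyParsable g s) :
    countMatrix k e s p p = (s.map (diagonalSeries k e p)).prod := by
  induction s with
  | nil => rw [countMatrix_nil, Matrix.one_apply_eq, List.map_nil, List.prod_nil]
  | cons X s ih => rw [countMatrix_cons_self he h, ih h.tail, List.map_cons, List.prod_cons]

lemma countMatrix_cons_of_lt [Fintype ι] (he : Function.Injective e) (hpq : p < q)
    {X : Symbol T g.NT} (h : IsFinitelyParsable g (X :: s)) :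
    countMatrix k e (X :: s) p q =
      diagonalSeries k e p X * countMatrix k e s p q +
        countMatrix k e [X] p q * countMatrix k e s q q +
        ∑ r with p < r ∧ r < q, countMatrix k e [X] p r * countMatrix k e s r q := by
  rw [countMatrix_cons he h, h.head.diagonalSeries_eq, Matrix.mul_apply,
    ← Finset.add_sum_erase _ _ (Finset.mem_univ p), ← Finset.add_sum_erase (Finset.univ.erase p) _
      (Finset.mem_erase.2 ⟨hpq.ne', Finset.mem_univ q⟩), ← add_assoc]
  refine congrArg _ (Finset.sum_subset (fun r hr ↦ ?_) fun r hr hr' ↦ ?_).symm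
  · obtain ⟨-, hpr, hrq⟩ := Finset.mem_filter.1 hr
    exact Finset.mem_erase.2 ⟨hrq.ne, Finset.mem_erase.2 ⟨hpr.ne', Finset.mem_univ r⟩⟩
  simp only [Finset.mem_erase, Finset.mem_filter, Finset.mem_univ, true_and, and_true] at hr hr'
  rcases lt_or_ge r p with hrp | hpr
  · rw [countMatrix_apply_eq_zero hrp, zero_mul]
  · rw [countMatrix_apply_eq_zero (p := r) (by grind), mul_zero]

end LeibnizMatrix

section Jacobian

open MvPolynomial

lemma isAlgebraic_of_derivation_eq_zero {F E : Type*} [Field F] [Field E] [Algebra F E]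
    [Algebra.EssFiniteType F E] (h : ∀ D : Derivation F E E, D = 0) : Algebra.IsAlgebraic F E := by
  have : Algebra.FormallyUnramified F E := by
    refine ⟨(Submodule.subsingleton_iff E).1 (subsingleton_of_bot_eq_top ?_)⟩
    rw [← KaehlerDifferential.span_range_derivation, eq_comm, Submodule.span_eq_bot]
    rintro _ ⟨x, rfl⟩
    refine (Module.forall_dual_apply_eq_zero_iff E _).1 fun f ↦ ?_
    exact congrArg (fun D ↦ D x) (h (f.compDer (KaehlerDifferential.D F E)))
  have := Algebra.FormallyUnramified.isSeparable F E
  infer_instance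

lemma derivation_adjoin_eq_zero {F K : Type*} [Field F] [Field K] [Algebra F K] {S : Set K}
    (D : Derivation F (IntermediateField.adjoin F S) (IntermediateField.adjoin F S))
    (hD : ∀ x : IntermediateField.adjoin F S, (x : K) ∈ S → D x = 0) : D = 0 := by
  ext1 ⟨x, hx⟩
  induction hx using IntermediateField.adjoin_induction with
  | mem x hx => exact hD _ hx
  | algebraMap a => exact D.map_algebraMap a
  | add x y hx hy ihx ihy =>
    exact (D.map_add ⟨x, hx⟩ ⟨y, hy⟩).trans (by rw [ihx, ihy]; exact add_zero 0)
  | inv x hx ih => exact (D.leibniz_inv ⟨x, hx⟩).trans (by rw [ih]; exact smul_zero _)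
  | mul x y hx hy ihx ihy =>
    refine (D.leibniz ⟨x, hx⟩ ⟨y, hy⟩).trans ?_
    rw [ihx, ihy]
    simp

lemma derivation_aeval {σ F A M : Type*} [Fintype σ] [CommRing F] [CommRing A] [Algebra F A]
    [AddCommGroup M] [Module A M] [Module F M] (D : Derivation F A M) (x : σ → A)
    (P : MvPolynomial σ F) : D (aeval x P) = ∑ j, aeval x (pderiv j P) • D (x j) := by
  classical
  induction P using MvPolynomial.induction_on with
  | C a => simp
  | add P Q hP hQ => simp only [map_add, add_smul, Finset.sum_add_distrib, hP, hQ]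
  | mul_X P i hP =>
    simp [hP, Derivation.leibniz, pderiv_X, Pi.single_apply, add_smul, mul_smul,
      Finset.sum_add_distrib, Finset.smul_sum, apply_ite (aeval x), ite_smul]

/-- This Jacobian criterion holds in every characteristic: a derivation of `F(x)` over `F` maps the
equations to a regular linear system for the values `D (x i)`, so that `F(x)` is unramified
over `F`. -/
theorem isAlgebraic_of_det_pderiv_ne_zero {σ F K : Type*} [Fintype σ] [DecidableEq σ] [Field F]
    [Field K] [Algebra F K] {P : σ → MvPolynomial σ F} {x : σ → K} (hP : ∀ i, aeval x (P i) = 0)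
    (hdet : (Matrix.of fun i j ↦ aeval x (pderiv j (P i))).det ≠ 0) (i : σ) :
    IsAlgebraic F (x i) := by
  let E := IntermediateField.adjoin F (Set.range x)
  let y (i : σ) : E := ⟨x i, IntermediateField.subset_adjoin F _ ⟨i, rfl⟩⟩
  have algebraMap_aeval (Q : MvPolynomial σ F) : algebraMap E K (aeval y Q) = aeval x Q :=
    (aeval_algebraMap_apply K y Q).symm
  let J : Matrix σ σ E := Matrix.of fun i j ↦ aeval y (pderiv j (P i))
  have hJ : J.det ≠ 0 := by
    refine fun h ↦ hdet ?_
    rw [← map_zero (algebraMap E K), ← h, RingHom.map_det]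
    congr 1
    ext i j
    exact (algebraMap_aeval _).symm
  have : Algebra.EssFiniteType F E :=
    IntermediateField.essFiniteType_iff.2 <|
      IntermediateField.fg_adjoin_of_finite (Set.finite_range x)
  have : Algebra.IsAlgebraic F E := by
    refine isAlgebraic_of_derivation_eq_zero fun D ↦ derivation_adjoin_eq_zero D ?_
    have hDy : (fun j ↦ D (y j)) = 0 := by
      refine Matrix.eq_zero_of_mulVec_eq_zero hJ (funext fun i ↦ ?_)
      have hPy : aeval y (P i) = 0 :=
        (algebraMap E K).injective (by rw [algebraMap_aeval, hP, map_zero])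
      exact (derivation_aeval D y (P i)).symm.trans (by rw [hPy, map_zero]; rfl)
    rintro _ ⟨j, hj⟩
    exact (congrArg D (Subtype.ext hj.symm)).trans (congrFun hDy j)
  exact IntermediateField.isAlgebraic_iff.1 (Algebra.IsAlgebraic.isAlgebraic (y i))

end Jacobian

section Diagonal

open MvPolynomial

variable {T : Type*} {g : ContextFreeGrammar T} {s : List (Symbol T g.NT)}

section SymbolPolynomial

variable {F : Type*} [CommRing F]

open Classical in
/-- The polynomial that stands for a symbol in the polynomial equations of a grammar: a variable for
a nonterminal that is finitely parsable, zero for the other nonterminals, and the constant `c x` for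
a terminal `x`. -/
noncomputable def symbolPolynomial (c : T → F) :
    Symbol T g.NT → MvPolynomial (FinitelyParsableNT g) F
  | .terminal x => C (c x)
  | .nonterminal A => if h : IsFinitelyParsable g [.nonterminal A] then X ⟨A, h⟩ else 0

lemma pderiv_symbolPolynomial_self (c : T → F) (B : FinitelyParsableNT g) :
    pderiv B (symbolPolynomial c (.nonterminal B.1)) = 1 := by
  rw [symbolPolynomial, dif_pos B.2, pderiv_X_self]

lemma pderiv_symbolPolynomial_of_ne (c : T → F) {B : FinitelyParsableNT g} {Y : Symbol T g.NT}
    (h : Y ≠ .nonterminal B.1) : pderiv B (symbolPolynomial c Y) = 0 := by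
  cases Y with
  | terminal x => exact pderiv_C
  | nonterminal A =>
    rw [symbolPolynomial]
    split_ifs with hA
    · exact pderiv_X_of_ne fun hAB ↦ h (congrArg (Symbol.nonterminal ·.1) hAB)
    · exact map_zero _

/-- The polynomial equations of a grammar. -/
noncomputable def grammarPolynomial (c : T → F) (A : FinitelyParsableNT g) :
    MvPolynomial (FinitelyParsableNT g) F :=
  X A - ∑ r : ProductiveRule A.1, (r.1.output.map (symbolPolynomial c)).prod

lemma pderiv_grammarPolynomial (c : T → F) (A B : FinitelyParsableNT g) :
    pderiv B (grammarPolynomial c A) =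
      (1 - leibnizMatrix (symbolPolynomial c) (symbolPolynomial c)) A B := by
  rw [grammarPolynomial, map_sub, map_sum, pderiv_X, Pi.single_apply, Matrix.sub_apply,
    Matrix.one_apply]
  exact congrArg _ (Finset.sum_congr rfl fun r _ ↦
    derivation_list_prod_eq_leibnizCoeff _ (pderiv_symbolPolynomial_self c B)
      (fun _ ↦ pderiv_symbolPolynomial_of_ne c) _)

lemma aeval_grammarPolynomial {K : Type*} [CommRing K] [Algebra F K] (c : T → F)
    (z : FinitelyParsableNT g → K) (A : FinitelyParsableNT g) :
    aeval z (grammarPolynomial c A) = z A -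
      ∑ r : ProductiveRule A.1, (r.1.output.map (aeval z ∘ symbolPolynomial c)).prod := by
  simp only [grammarPolynomial, map_sub, map_sum, aeval_X, map_list_prod, List.map_map]

lemma aeval_pderiv_grammarPolynomial {K : Type*} [CommRing K] [Algebra F K] (c : T → F)
    (z : FinitelyParsableNT g → K) :
    (Matrix.of fun A B ↦ aeval z (pderiv B (grammarPolynomial c A))) =
      1 - leibnizMatrix (aeval z ∘ symbolPolynomial c) (aeval z ∘ symbolPolynomial c) := by
  have hmap := mapMatrix_leibnizMatrix (aeval (R := F) z).toRingHom (symbolPolynomial (g := g) c)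
    (symbolPolynomial c)
  refine Eq.trans ?_ (congrArg (1 - ·) hmap)
  rw [← map_one ((aeval (R := F) z).toRingHom.mapMatrix), ← map_sub]
  ext A B
  exact congrArg (aeval z) (pderiv_grammarPolynomial c A B)

end SymbolPolynomial

variable {ι k K : Type*} [LinearOrder ι] [Finite ι] [CommRing k] [IsDomain k] [Field K]
  {e : ι → T} {p q : ι} {φ : MvPowerSeries ι k →+* K} {F : Subfield K}

lemma isAlgebraic_diagonalSeries (he : Function.Injective e) (hφ : Function.Injective φ)
    (hX : φ (MvPowerSeries.X p) ∈ F) (Y : Symbol T g.NT) :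
    IsAlgebraic F (φ (diagonalSeries k e p Y)) := by
  have terminal_mem (x : T) : φ (diagonalSeries k e p (.terminal x : Symbol T g.NT)) ∈ F := by
    rcases diagonalSeries_terminal (g := g) (k := k) (p := p) he x with h | h <;> rw [h]
    · exact map_zero φ ▸ F.zero_mem
    · exact hX
  let c (x : T) : F := ⟨_, terminal_mem x⟩
  let z (A : FinitelyParsableNT g) : K := φ (diagonalSeries k e p (.nonterminal A.1))
  have aeval_symbolPolynomial :
      aeval z ∘ symbolPolynomial (g := g) c = φ ∘ diagonalSeries k e p := by
    ext (x | A)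
    · exact aeval_C z (c x)
    · by_cases hA : IsFinitelyParsable g [.nonterminal A]
      · simp [symbolPolynomial, hA, z]
      · simp [symbolPolynomial, hA, diagonalSeries_eq_zero]
  have aeval_eq_zero (A : FinitelyParsableNT g) : aeval z (grammarPolynomial c A) = 0 := by
    rw [aeval_grammarPolynomial, aeval_symbolPolynomial, sub_eq_zero]
    simp only [z]
    rw [A.2.diagonalSeries_eq, countMatrix_nonterminal A.2, Matrix.sum_apply, map_sum]
    refine Finset.sum_congr rfl fun r _ ↦ ?_
    rw [countMatrix_self_eq_prod he (A.2.output r), map_list_prod, List.map_map]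
  have jacobian : (Matrix.of fun A B ↦ aeval z (pderiv B (grammarPolynomial c A))) =
      φ.mapMatrix (1 - leibnizMatrix (diagonalSeries (g := g) k e p) (diagonalSeries k e p)) := by
    rw [map_sub, map_one, mapMatrix_leibnizMatrix, ← aeval_symbolPolynomial,
      aeval_pderiv_grammarPolynomial]
  cases Y with
  | terminal x => exact isAlgebraic_algebraMap (c x)
  | nonterminal A =>
    by_cases hA : IsFinitelyParsable g [.nonterminal A]
    · refine isAlgebraic_of_det_pderiv_ne_zero aeval_eq_zero ?_ (⟨A, hA⟩ : FinitelyParsableNT g)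
      rw [jacobian, ← RingHom.map_det, map_ne_zero_iff φ hφ]
      exact det_one_sub_leibnizMatrix_diagonalSeries_ne_zero e p p
    · rw [diagonalSeries_eq_zero hA, map_zero]
      exact isAlgebraic_zero

end Diagonal

section OffDiagonal

variable {T ι k : Type*} {g : ContextFreeGrammar T} {s : List (Symbol T g.NT)} [LinearOrder ι]
  [Finite ι] [CommRing k] {e : ι → T} {p q : ι}

lemma countMatrix_sub_sum_leibnizCoeff_mem {O : Subring (MvPowerSeries ι k)}
    (he : Function.Injective e) (hpq : p < q) (hX : MvPowerSeries.X q ∈ O)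
    (hqq : ∀ s : List (Symbol T g.NT), IsFinitelyParsable g s → countMatrix k e s q q ∈ O)
    (hlt : ∀ s : List (Symbol T g.NT), IsFinitelyParsable g s → ∀ r < q, countMatrix k e s p r ∈ O)
    (hgt : ∀ s : List (Symbol T g.NT), IsFinitelyParsable g s → ∀ r > p, r < q →
      countMatrix k e s r q ∈ O) (hs : IsFinitelyParsable g s) :
    countMatrix k e s p q - ∑ B : FinitelyParsableNT g,
      leibnizCoeff (diagonalSeries k e p) (diagonalSeries k e q) s (.nonterminal B.1) *
        countMatrix k e [.nonterminal B.1] p q ∈ O := by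
  have := Fintype.ofFinite ι
  induction s with
  | nil => simp [leibnizCoeff, countMatrix_nil, hpq.ne]
  | cons Y s ih =>
    have hp : diagonalSeries k e p Y ∈ O :=
      hs.head.diagonalSeries_eq (k := k) (e := e) ▸ hlt _ hs.head p hpq
    have hcross : ∑ r with p < r ∧ r < q, countMatrix k e [Y] p r * countMatrix k e s r q ∈ O :=
      sum_mem fun r hr ↦ by
        obtain ⟨-, hpr, hrq⟩ := Finset.mem_filter.1 hr
        exact O.mul_mem (hlt _ hs.head r hrq) (hgt _ hs.tail r hpr hrq)
    have hih := O.add_mem (O.mul_mem hp (ih hs.tail)) hcross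
    rw [countMatrix_cons_of_lt he hpq hs]
    cases Y with
    | terminal x =>
      have hx : countMatrix k e ([.terminal x] : List (Symbol T g.NT)) p q *
          countMatrix k e s q q ∈ O := by
        refine O.mul_mem ?_ (hqq s hs.tail)
        rcases countMatrix_terminal (g := g) (k := k) (p := p) (q := q) he x with h | h <;> rw [h]
        exacts [O.zero_mem, hX]
      rw [sum_leibnizCoeff_cons_terminal]
      convert O.add_mem hih hx using 1
      ring
    | nonterminal A =>
      rw [sum_leibnizCoeff_cons_nonterminal _ _ ⟨A, hs.head⟩, ← countMatrix_self_eq_prod he hs.tail]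
      convert hih using 1
      ring

end OffDiagonal

section OffDiagonal

variable {T ι k : Type*} {g : ContextFreeGrammar T} {s : List (Symbol T g.NT)} [LinearOrder ι]
  [CommRing k] {e : ι → T} {p q : ι}

lemma one_sub_leibnizMatrix_mem {R : Type*} [CommRing R] {O : Subring R} {u v : Symbol T g.NT → R}
    (hu : ∀ Y, u Y ∈ O) (hv : ∀ Y, v Y ∈ O) (A B : FinitelyParsableNT g) :
    (1 - leibnizMatrix u v) A B ∈ O := by
  rw [Matrix.sub_apply, Matrix.one_apply]
  refine O.sub_mem ?_ (sum_mem fun r _ ↦ leibnizCoeff_mem hu hv _ _)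
  split_ifs
  exacts [O.one_mem, O.zero_mem]

lemma one_sub_leibnizMatrix_mulVec_countMatrix (u v : Symbol T g.NT → MvPowerSeries ι k)
    (A : FinitelyParsableNT g) :
    ((1 - leibnizMatrix u v).mulVec fun B ↦ countMatrix k e [.nonterminal B.1] p q) A =
      ∑ r : ProductiveRule A.1, (countMatrix k e r.1.output p q -
        ∑ B : FinitelyParsableNT g, leibnizCoeff u v r.1.output (.nonterminal B.1) *
          countMatrix k e [.nonterminal B.1] p q) := by
  rw [Matrix.sub_mulVec, Matrix.one_mulVec, Pi.sub_apply, countMatrix_nonterminal A.2,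
    Matrix.sum_apply, Finset.sum_sub_distrib, Finset.sum_comm]
  exact congrArg _ (Finset.sum_congr rfl fun B _ ↦ Finset.sum_mul _ _ _)

variable {K : Type*} [IsDomain k] [Field K] {φ : MvPowerSeries ι k →+* K}

lemma map_countMatrix_mem_of_diagonalSeries_mem [Finite ι] {E : Subfield K} {O : Subring K}
    (he : Function.Injective e) (hφ : Function.Injective φ) (hE : E.toSubring ≤ O) (hpq : p < q)
    (hX : φ (MvPowerSeries.X q) ∈ O)
    (hp : ∀ Y : Symbol T g.NT, φ (diagonalSeries k e p Y) ∈ E)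
    (hq : ∀ Y : Symbol T g.NT, φ (diagonalSeries k e q Y) ∈ E)
    (hlt : ∀ s : List (Symbol T g.NT), IsFinitelyParsable g s → ∀ r < q,
      φ (countMatrix k e s p r) ∈ O)
    (hgt : ∀ s : List (Symbol T g.NT), IsFinitelyParsable g s → ∀ r > p, r < q →
      φ (countMatrix k e s r q) ∈ O) (hs : IsFinitelyParsable g s) :
    φ (countMatrix k e s p q) ∈ O := by
  have sub_sum_mem {s : List (Symbol T g.NT)} (hs : IsFinitelyParsable g s) :=
    countMatrix_sub_sum_leibnizCoeff_mem (O := O.comap φ) he hpq hX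
      (fun s hs ↦ by
        rw [countMatrix_self_eq_prod he hs]
        refine list_prod_mem fun x hx ↦ ?_
        obtain ⟨Y, -, rfl⟩ := List.mem_map.1 hx
        exact hE (hq Y)) hlt hgt hs
  have nonterminal_mem (B : FinitelyParsableNT g) :
      φ (countMatrix k e [.nonterminal B.1] p q) ∈ O := by
    refine mem_of_mulVec_mem hE
      (M := φ.mapMatrix (1 - leibnizMatrix (diagonalSeries k e p) (diagonalSeries k e q)))
      (v := φ ∘ fun B : FinitelyParsableNT g ↦ countMatrix k e [.nonterminal B.1] p q)
      (one_sub_leibnizMatrix_mem (O := E.toSubring.comap φ) hp hq) ?_ (fun A ↦ ?_) B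
    · rw [← RingHom.map_det, map_ne_zero_iff φ hφ]
      exact det_one_sub_leibnizMatrix_diagonalSeries_ne_zero e p q
    · rw [RingHom.mapMatrix_apply, ← RingHom.map_mulVec,
        one_sub_leibnizMatrix_mulVec_countMatrix, map_sum]
      exact sum_mem fun r _ ↦ sub_sum_mem (A.2.output r)
  have map_sum_mem : φ (∑ B : FinitelyParsableNT g,
      leibnizCoeff (diagonalSeries k e p) (diagonalSeries k e q) s (.nonterminal B.1) *
        countMatrix k e [.nonterminal B.1] p q) ∈ O := by
    rw [map_sum]
    refine sum_mem fun B _ ↦ ?_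
    rw [map_mul]
    exact O.mul_mem (hE (leibnizCoeff_mem (E := E.toSubring.comap φ) hp hq _ _)) (nonterminal_mem B)
  simpa using O.add_mem (sub_sum_mem hs) map_sum_mem

theorem map_countMatrix_mem [Fintype ι] {F : ι → Subfield K} {O : Subring K}
    (hι : 2 < Fintype.card ι) (he : Function.Injective e) (hφ : Function.Injective φ)
    (hX : ∀ o p, p ≠ o → φ (MvPowerSeries.X p) ∈ F o) (hO : ∀ o x, IsAlgebraic (F o) x → x ∈ O)
    (p q : ι) (hs : IsFinitelyParsable g s) : φ (countMatrix k e s p q) ∈ O := by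
  let E (o : ι) : Subfield K := (algebraicClosure (F o) K).toSubfield
  have hE (o : ι) : (E o).toSubring ≤ O := fun x hx ↦ hO o x (mem_algebraicClosure_iff.1 hx)
  have diagonalSeries_mem {o p : ι} (h : p ≠ o) (Y : Symbol T g.NT) :
      φ (diagonalSeries k e p Y) ∈ E o :=
    mem_algebraicClosure_iff.2 (isAlgebraic_diagonalSeries he hφ (hX o p h) Y)
  induction q using WellFoundedLT.induction generalizing s p with
  | ind q ihq =>
  induction p using WellFoundedGT.induction generalizing s with
  | ind p ihp =>
  obtain ⟨o, -, ho⟩ := Finset.exists_mem_notMem_of_card_lt_card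
    ((Finset.card_le_two (a := p) (b := q)).trans_lt hι)
  obtain ⟨hop, hoq⟩ : p ≠ o ∧ q ≠ o := by simpa [eq_comm] using ho
  rcases lt_trichotomy p q with hpq | rfl | hqp
  · exact map_countMatrix_mem_of_diagonalSeries_mem he hφ (hE o) hpq
      (hO o _ (isAlgebraic_algebraMap (⟨_, hX o q hoq⟩ : F o)))
      (diagonalSeries_mem hop) (diagonalSeries_mem hoq) (fun s hs r hr ↦ ihq r hr p hs)
      (fun s hs r hr _ ↦ ihp r hr hs) hs
  · rw [countMatrix_self_eq_prod he hs, map_list_prod, List.map_map]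
    refine hE o (list_prod_mem fun x hx ↦ ?_)
    obtain ⟨Y, -, rfl⟩ := List.mem_map.1 hx
    exact diagonalSeries_mem hop Y
  · rw [countMatrix_apply_eq_zero hqp, map_zero]
    exact O.zero_mem

end OffDiagonal

section ValuationRing

lemma exists_valuationSubring_of_isPrime {A K : Type*} [CommRing A] [Field K] (f : A →+* K)
    (hf : Function.Injective f) (P : Ideal A) [P.IsPrime] :
    ∃ O : ValuationSubring K, (∀ x, f x ∈ O) ∧ ∀ x, O.valuation (f x) < 1 ↔ x ∈ P := by
  have isUnit_map (y : P.primeCompl) : IsUnit (f y) := by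
    rw [isUnit_iff_ne_zero, map_ne_zero_iff f hf]
    rintro h
    exact y.2 (h ▸ P.zero_mem)
  let φ : Localization.AtPrime P →+* K := IsLocalization.lift isUnit_map
  have hφ (x : A) : φ (algebraMap A _ x) = f x := IsLocalization.lift_eq isUnit_map x
  obtain ⟨O, hO, hlocal⟩ := IsLocalRing.exists_factor_valuationRing φ
  let φO : Localization.AtPrime P →+* O := φ.codRestrict O.toSubring hO
  have : IsLocalHom φO := hlocal
  refine ⟨O, fun x ↦ hφ x ▸ hO _, fun x ↦ ?_⟩
  rw [← IsLocalization.AtPrime.to_map_mem_maximal_iff (Localization.AtPrime P) P x,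
    IsLocalRing.mem_maximalIdeal, ← map_mem_nonunits_iff φO, ← IsLocalRing.mem_maximalIdeal, ← hφ]
  exact (O.valuation_lt_one_iff (φO (algebraMap A _ x))).symm

lemma mem_valuationSubring_of_isAlgebraic {K : Type*} [Field K] {F : Subfield K}
    {O : ValuationSubring K} (hF : F.toSubring ≤ O.toSubring) {x : K} (hx : IsAlgebraic F x) :
    x ∈ O := by
  let : Algebra F O := (Subring.inclusion hF).toAlgebra
  have : IsScalarTower F O K := .of_algebraMap_eq fun _ ↦ rfl
  obtain ⟨y, rfl⟩ := IsIntegrallyClosed.isIntegral_iff.1 (hx.isIntegral.tower_top (A := O))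
  exact y.2

open MvPolynomial

variable {ι k : Type*} [Field k] {m : ι →₀ ℕ}

lemma prime_one_sub_monomial {i : ι} (hi : m i = 1) :
    Prime (1 - monomial m 1 : MvPolynomial ι k) := by
  classical
  have hm : m ≠ 0 := by rintro rfl; simp at hi
  have support_eq : (1 - monomial m 1 : MvPolynomial ι k).support = {0, m} := by
    ext d
    rw [mem_support_iff, coeff_sub, coeff_one, coeff_monomial]
    grind
  refine (irreducible_of_disjoint_support (d := m) ?_ ?_ hi ?_ fun r hr ↦ ?_).prime
  · rw [support_eq]
    exact ⟨0, by simp, m, by simp, hm.symm⟩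
  · simp [support_eq]
  · simp [support_eq, Set.pairwiseDisjoint_insert]
  · refine isUnit_of_dvd_one ?_
    simpa [coeff_one, coeff_monomial, hm] using hr 0

lemma eq_zero_of_one_sub_monomial_dvd {o : ι} (ho : m o ≠ 0) {f : MvPolynomial ι k}
    (hf : f ∈ supported k {o}ᶜ) (hdvd : 1 - monomial m 1 ∣ f) : f = 0 := by
  have degreeOf_eq : degreeOf o (1 - monomial m 1 : MvPolynomial ι k) = m o := by
    have := degreeOf_monomial_eq m o (neg_ne_zero.2 (one_ne_zero (α := k)))
    rw [sub_eq_neg_add, ← map_neg, degreeOf_add_eq_of_degreeOf_lt, this]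
    rwa [this, degreeOf_one, Nat.pos_iff_ne_zero]
  obtain ⟨h, rfl⟩ := hdvd
  by_contra hne
  have degreeOf_mul := degreeOf_mul_eq (n := o) (left_ne_zero_of_mul hne) (right_ne_zero_of_mul hne)
  have : degreeOf o ((1 - monomial m 1) * h) = 0 := by
    by_contra hdeg
    exact mem_supported.1 hf (mem_vars_iff_degreeOf_ne_zero.2 hdeg) rfl
  omega

lemma exists_valuationSubring_one_sub_monomial {K : Type*} [Field K] [Algebra k K]
    (ψ : MvPolynomial ι k →ₐ[k] K) (hψ : Function.Injective ψ) {i : ι} (hi : m i = 1) :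
    ∃ O : ValuationSubring K, (ψ (1 - monomial m 1))⁻¹ ∉ O ∧ ∀ o, m o ≠ 0 →
      (IntermediateField.adjoin k (ψ '' (X '' {o}ᶜ))).toSubfield.toSubring ≤ O.toSubring := by
  have hprime := prime_one_sub_monomial (k := k) hi
  have := (Ideal.span_singleton_prime hprime.ne_zero).2 hprime
  obtain ⟨O, hO, hlt⟩ := exists_valuationSubring_of_isPrime ψ.toRingHom hψ
    (Ideal.span {1 - monomial m 1})
  have inv_mem_iff (f : MvPolynomial ι k) (hf : f ≠ 0) :
      (ψ f)⁻¹ ∈ O ↔ ¬ 1 - monomial m 1 ∣ f := by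
    rw [← Ideal.mem_span_singleton, ← hlt, not_lt, ← ValuationSubring.valuation_le_one_iff,
      map_inv₀, inv_le_one₀]
    · rfl
    · rwa [zero_lt_iff, Valuation.ne_zero_iff, map_ne_zero_iff ψ hψ]
  refine ⟨O, fun h ↦ (inv_mem_iff _ hprime.ne_zero).1 h dvd_rfl, fun o ho x hx ↦ ?_⟩
  obtain ⟨_, hr, _, hs, rfl⟩ := IntermediateField.mem_adjoin_iff_div.1 hx
  rw [← AlgHom.map_adjoin, ← supported_eq_adjoin_X] at hr hs
  obtain ⟨r, -, rfl⟩ := hr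
  obtain ⟨s, hs, rfl⟩ := hs
  rw [div_eq_mul_inv]
  refine O.mul_mem _ _ (hO r) ?_
  by_cases h0 : s = 0
  · simp [h0]
  · exact (inv_mem_iff s h0).2 (mt (eq_zero_of_one_sub_monomial_dvd ho hs) h0)

end ValuationRing

section IndicatorSeries

variable {ι k : Type*} [CommRing k]

open Classical in
/-- The power series whose coefficients are one at the exponents that satisfy `P`, and zero at the
others. -/
noncomputable def indicatorSeries (k : Type*) [CommRing k] (P : (ι →₀ ℕ) → Prop) :
    MvPowerSeries ι k :=
  fun d ↦ if P d then 1 else 0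

open Classical in
lemma coeff_indicatorSeries (P : (ι →₀ ℕ) → Prop) (d : ι →₀ ℕ) :
    MvPowerSeries.coeff d (indicatorSeries k P) = if P d then 1 else 0 := rfl

lemma indicatorSeries_mul_one_sub_monomial {P Q : (ι →₀ ℕ) → Prop} {m : ι →₀ ℕ}
    (hP : ∀ d, P (d + m) ↔ P d) (hQ : ∀ d, Q d ↔ P d ∧ ¬ m ≤ d) :
    indicatorSeries k P * (1 - MvPowerSeries.monomial m 1) = indicatorSeries k Q := by
  classical
  ext d
  rw [mul_sub, mul_one, map_sub, MvPowerSeries.coeff_mul_monomial, coeff_indicatorSeries,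
    coeff_indicatorSeries, coeff_indicatorSeries, mul_one, hQ]
  by_cases hm : m ≤ d
  · have := hP (d - m)
    rw [tsub_add_cancel_of_le hm] at this
    simp [hm, this]
  · simp [hm]

lemma indicatorSeries_not (P : (ι →₀ ℕ) → Prop) :
    indicatorSeries k (fun d ↦ ¬ P d) = indicatorSeries k (fun _ ↦ True) - indicatorSeries k P := by
  classical
  ext d
  rw [map_sub, coeff_indicatorSeries, coeff_indicatorSeries, coeff_indicatorSeries]
  by_cases hd : P d <;> simp [hd]

lemma indicatorSeries_eq_zero : indicatorSeries k (fun d : ι →₀ ℕ ↦ d = 0) = 1 := by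
  classical
  ext d
  rw [coeff_indicatorSeries, MvPowerSeries.coeff_one]
  congr

lemma indicatorSeries_true_mul_prod (s : Finset ι) :
    indicatorSeries k (fun _ ↦ True) * ∏ i ∈ s, (1 - MvPowerSeries.X i) =
      indicatorSeries k fun d ↦ ∀ i ∈ s, d i = 0 := by
  classical
  induction s using Finset.induction_on with
  | empty => simp
  | insert i s hi ih =>
    rw [Finset.prod_insert hi, mul_left_comm, ih, mul_comm]
    refine indicatorSeries_mul_one_sub_monomial (fun d ↦ ?_) fun d ↦ ?_
    · refine forall₂_congr fun j hj ↦ ?_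
      rw [Finsupp.add_apply, Finsupp.single_eq_of_ne (ne_of_mem_of_not_mem hj hi), add_zero]
    · rw [Finset.forall_mem_insert, and_comm, Finsupp.single_le_iff, Nat.not_le, Nat.lt_one_iff]

lemma indicatorSeries_true_mul_prod_univ [Fintype ι] :
    indicatorSeries k (fun _ ↦ True) * ∏ i : ι, (1 - MvPowerSeries.X i) = 1 := by
  rw [indicatorSeries_true_mul_prod, ← indicatorSeries_eq_zero]
  simp [Finsupp.ext_iff]

lemma indicatorSeries_forall_eq_mul [Finite ι] [Nonempty ι] :
    indicatorSeries k (fun d : ι →₀ ℕ ↦ ∀ i j, d i = d j) *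
      (1 - MvPowerSeries.monomial (Finsupp.equivFunOnFinite.symm 1) 1) = 1 := by
  rw [indicatorSeries_mul_one_sub_monomial (Q := fun d ↦ d = 0) (by simp), indicatorSeries_eq_zero]
  obtain ⟨i⟩ := ‹Nonempty ι›
  refine fun d ↦ ⟨?_, fun ⟨hd, hle⟩ ↦ ?_⟩
  · rintro rfl
    exact ⟨fun _ _ ↦ rfl, fun hle ↦ Nat.not_succ_le_zero 0 (hle i)⟩
  simp only [Finsupp.le_def, not_forall, not_le] at hle
  obtain ⟨i, hi⟩ := hle
  ext j
  rw [hd j i]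
  exact Nat.lt_one_iff.1 hi

variable {K : Type*} [Field K] {F : ι → Subfield K}

lemma map_indicatorSeries_true_mem [Finite ι] [Nontrivial ι] {φ : MvPowerSeries ι k →+* K}
    {O : Subring K} (hX : ∀ o i, i ≠ o → φ (MvPowerSeries.X i) ∈ F o)
    (hF : ∀ o, (F o).toSubring ≤ O) : φ (indicatorSeries k fun _ ↦ True) ∈ O := by
  have := Fintype.ofFinite ι
  have map_eq : φ (indicatorSeries k fun _ ↦ True) = ∏ i : ι, (1 - φ (MvPowerSeries.X i))⁻¹ := by
    have := congrArg φ (indicatorSeries_true_mul_prod_univ (ι := ι) (k := k))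
    simp only [map_mul, map_prod, map_sub, map_one] at this
    rw [Finset.prod_inv_distrib, eq_inv_of_mul_eq_one_left this]
  rw [map_eq]
  refine prod_mem fun i _ ↦ ?_
  obtain ⟨o, ho⟩ := exists_ne i
  exact hF o ((F o).inv_mem ((F o).sub_mem (F o).one_mem (hX o i ho.symm)))

end IndicatorSeries

section SeparatingValuation

variable {ι k K : Type*} [Finite ι] [Nonempty ι] [Field k] [Field K] [Algebra k K]
  {φ : MvPowerSeries ι k →ₐ[k] K}

lemma exists_valuationSubring_map_indicatorSeries_notMem (hφ : Function.Injective φ) :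
    ∃ (O : ValuationSubring K) (F : ι → Subfield K),
      (∀ o i, i ≠ o → φ (MvPowerSeries.X i) ∈ F o) ∧ (∀ o, (F o).toSubring ≤ O.toSubring) ∧
        φ (indicatorSeries k fun d ↦ ∀ i j, d i = d j) ∉ O := by
  let ψ : MvPolynomial ι k →ₐ[k] K := φ.comp (MvPolynomial.coeToMvPowerSeries.algHom k)
  have hψ : Function.Injective ψ := hφ.comp (MvPolynomial.coe_injective ι k)
  obtain ⟨O, inv_notMem, hO⟩ := exists_valuationSubring_one_sub_monomial ψ hψ
    (m := Finsupp.equivFunOnFinite.symm 1) (i := Classical.arbitrary ι) rfl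
  refine ⟨O, _, fun o i hi ↦ ?_, fun o ↦ hO o one_ne_zero, ?_⟩
  · refine IntermediateField.subset_adjoin k _ ⟨_, ⟨i, hi, rfl⟩, ?_⟩
    simp [ψ]
  · have map_denom : ψ (1 - MvPolynomial.monomial (Finsupp.equivFunOnFinite.symm 1) 1) =
        φ (1 - MvPowerSeries.monomial (Finsupp.equivFunOnFinite.symm 1) 1) := by
      rw [map_sub, map_sub, map_one ψ, map_one φ]
      simp [ψ]
    have map_mul_eq_one := congrArg φ (indicatorSeries_forall_eq_mul (ι := ι) (k := k))
    rw [map_mul, map_one φ] at map_mul_eq_one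
    rwa [eq_inv_of_mul_eq_one_left map_mul_eq_one, ← map_denom]

end SeparatingValuation

section Main

variable {T ι : Type*} [Fintype ι] [LinearOrder ι] {g : ContextFreeGrammar T} {e : ι → T}

theorem exists_card_parseTree_sortedWord_ne (k : Type*) [Field k] (hι : 2 < Fintype.card ι)
    (he : Function.Injective e) (hg : IsFinitelyParsable g [.nonterminal g.initial]) :
    ∃ d, (Nat.card (g.ParseTree g.initial (sortedWord e d)) : k) ≠
      if ∃ i j, d i ≠ d j then 1 else 0 := by
  have : Nontrivial ι := Fintype.one_lt_card_iff_nontrivial.1 (by omega)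
  obtain ⟨p, hp⟩ : ∃ p : ι, ∀ i, p ≤ i := Finite.exists_min id
  let φ := IsScalarTower.toAlgHom k (MvPowerSeries ι k) (FractionRing (MvPowerSeries ι k))
  have hφ : Function.Injective φ := IsFractionRing.injective _ _
  obtain ⟨O, F, hX, hF, notMem⟩ := exists_valuationSubring_map_indicatorSeries_notMem hφ
  by_contra! hcard
  have sum_countMatrix_eq : ∑ q, countMatrix k e [.nonterminal g.initial] p q =
      indicatorSeries k fun d ↦ ∃ i j, d i ≠ d j := by
    ext d
    rw [coeff_indicatorSeries]
    convert (coeff_sum_countMatrix he hp hg).trans (hcard d)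
  have diagonal_eq : (indicatorSeries k fun d : ι →₀ ℕ ↦ ∀ i j, d i = d j) =
      indicatorSeries k (fun _ ↦ True) - ∑ q, countMatrix k e [.nonterminal g.initial] p q := by
    rw [sum_countMatrix_eq, ← indicatorSeries_not]
    simp only [not_exists, not_not]
  refine notMem ?_
  rw [diagonal_eq, map_sub, map_sum]
  exact O.toSubring.sub_mem
    (map_indicatorSeries_true_mem (O := O.toSubring) (φ := φ.toRingHom) hX hF)
    (O.toSubring.sum_mem fun q _ ↦ map_countMatrix_mem (φ := φ.toRingHom) hι he hφ hX
      (fun o _ ↦ mem_valuationSubring_of_isAlgebraic (hF o)) p q hg)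

theorem GF2Grammar.exists_not_sortedWord_mem_language_iff (G : GF2Grammar T)
    (hι : 2 < Fintype.card ι) (he : Function.Injective e) :
    ∃ d, ¬ (sortedWord e d ∈ G.language ↔ ∃ i j, d i ≠ d j) := by
  by_contra! hmem
  replace hmem (d : ι →₀ ℕ) :
      Odd (Nat.card (G.toCFG.ParseTree G.toCFG.initial (sortedWord e d))) ↔ ∃ i j, d i ≠ d j :=
    hmem d
  have hg : IsFinitelyParsable G.toCFG [.nonterminal G.toCFG.initial] := by
    refine ⟨?_, G.finite_parseTree⟩
    obtain ⟨i, j, hij⟩ := (Fintype.one_lt_card_iff (α := ι)).1 (by omega)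
    have hodd := (hmem (Finsupp.single i 1)).2 ⟨i, j, by simp [hij]⟩
    obtain ⟨t⟩ := (Nat.card_pos_iff.1 hodd.pos).1
    exact ⟨t.1⟩
  obtain ⟨d, hd⟩ := exists_card_parseTree_sortedWord_ne (ZMod 2) hι he hg
  refine hd ?_
  split_ifs with hij
  · exact (ZMod.natCast_eq_one_iff_odd).2 ((hmem d).2 hij)
  · exact (ZMod.natCast_eq_zero_iff_even).2 (Nat.not_odd_iff_even.1 (mt (hmem d).1 hij))

theorem GF2Grammar.language_ne_neOrNeLanguage {e : Fin 3 → T} (G : GF2Grammar T)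
    (he : Function.Injective e) : G.language ≠ neOrNeLanguage (e 0) (e 1) (e 2) := by
  intro hL
  obtain ⟨d, hd⟩ := G.exists_not_sortedWord_mem_language_iff (by simp) he
  exact hd (hL ▸ sortedWord_mem_neOrNeLanguage_iff he d)

end Main

theorem mainTheorem5 {T : Type*} (a b c : T) (hab : a ≠ b) (hac : a ≠ c) (hbc : b ≠ c) :
    (∀ G : GF2Grammar T, G.language ≠ neOrNeLanguage a b c) ∧
      (neOrNeLanguage a b c).IsInherentlyAmbiguous := by
  have injective : Function.Injective ![a, b, c] := by
    intro i j h
    fin_cases i <;> fin_cases j <;> simp_all [eq_comm]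
  have language_ne (G : GF2Grammar T) : G.language ≠ neOrNeLanguage a b c :=
    G.language_ne_neOrNeLanguage injective
  refine ⟨language_ne, isContextFree_neOrNeLanguage a b c, fun g hL hg ↦ ?_⟩
  exact language_ne (.ofIsUnambiguous g hg) ((GF2Grammar.language_ofIsUnambiguous hg).trans hL)
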